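/- \textbf{The game.} A principal and $n\ge 2$ agents may launch a project. The state $\theta\in\Theta=[-1,1]$ has an atomless prior distribution $F$. The principal publicly chooses a test $t=(\mathcal S,\pi)$ (a measurable signal space and a Markov kernel $\pi$ from $\Theta$ to $\mathcal S$) and privately observes the signal $s\sim\pi(\cdot\mid\theta)$. She then proposes the project or forgoes it; a proposal costs her $c>0$. After a proposal she sends cheap-talk messages $(m_1,\dots,m_n)\in\mathcal M^n$, agent $i$ seeing only $m_i$, where the message space $\mathcal M$ is a measurable space containing $2^{\mathcal S}$, in which the reports $s\mapsto\{s\}$ form a measurable embedding of $\mathcal S$. Under private messaging the profile is unrestricted; under public messaging it is common knowledge that $m_1=\dots=m_n$. Each agent then votes, and a proposed project is launched if and only if at least $k$ agents accept, where $1\le k\le n$. Independently, each agent is mechanical with probability $\varepsilon\in(0,1)$, accepting with probability $1/2$, and is otherwise rational. If the project is not launched, payoffs (apart from the proposal cost) are zero. \textbf{Linear environment.} From a launch the principal gets $u(\theta)=\theta$ and agent $i$ gets $v_i(\theta)=\alpha_i\theta+\beta_i$, with $\alpha_i\in\{-1,1\}$ and $\beta_i\in(-1,1)$. The acceptance thresholds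 $\delta_i=-\beta_i/\alpha_i$ are pairwise distinct. \textbf{Equilibrium and values.} Given a test, a weak perfect Bayesian equilibrium consists of a proposal strategy $\gamma:\mathcal S\to[0,1]$, a messaging strategy (a Markov kernel from $\mathcal S$ to feasible message profiles), voting strategies $\tau_i:\mathcal M\to[0,1]$ of the rational types, and beliefs of all players at their information sets, such that each strategy is sequentially rational given the player's beliefs and the other strategies, and beliefs follow Bayes' rule on the path of play (and are arbitrary off it). An outcome $\omega=(\omega_p,\omega_\ell)$ gives, for each state $\theta$, the probability $\omega_p(\theta)$ of a proposal and the probability $\omega_\ell(\theta)$ of a launch conditional on a proposal. It is implementable given $t$ under a messaging regime if some such equilibrium under that regime induces it. The value of a regime is the supremum of $$\int_\Theta\bigl(\theta\,\omega_\ell(\theta)-c\bigr)\,\omega_p(\theta)\,dF(\theta)$$ over all tests $t$ and all outcomes $\omega$ implementable given $t$ under that regime. Public messaging is strictly better than private messaging if its value is strictly larger. \textbf{Theorem.} Let $n\ge2$, $1\le k\le n$, $\varepsilon\in(0,1)$ and $(\alpha_i,\beta_i)_{i\le n}$ be as above. For every choice of message spaces as above (one for each signal space), the following are equivalent. (a)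 There exist an atomless prior distribution $F$ on $[-1,1]$ and a cost $c>0$ for which public messaging is strictly better than private messaging. (b) Two agents are the principal's conflicting allies: there are $i\ne j$ with $\alpha_i=-1$, $\alpha_j=1$ and $0<\delta_i<\delta_j<1$. -/

import Mathlib

open MeasureTheory ProbabilityTheory

noncomputable section

namespace Messaging

/-- The state space `Θ = [-1, 1]`. -/
abbrev State : Type := Set.Icc (-1 : ℝ) 1

/-- The primitives of the project game with `n` agents: approval quota `k`, trembling error `ε`,
proposal cost `c`, prior `F`, payoffs `u` (principal) and `v i` (agents) from a launched project. -/
structure Game (n : ℕ) where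
  k : ℕ
  ε : ℝ
  c : ℝ
  F : Measure State
  u : State → ℝ
  v : Fin n → State → ℝ

/-- A test: a measurable signal space and a Markov kernel from states to signals. -/
structure Test where
  S : Type
  [mS : MeasurableSpace S]
  π : Kernel State S
  [markov : IsMarkovKernel π]

attribute [instance] Test.mS Test.markov

/-- A message space for the signal space `S`: a measurable space that contains (a copy of) `2^S`,
in which truthful reports of signals can be sent and told apart measurably. -/
structure MessageSpace (S : Type) [MeasurableSpace S] where
  M : Type
  [mM : MeasurableSpace M]
  incl : Set S → M
  incl_injective : Function.Injective incl
  report : MeasurableEmbedding (fun s : S => incl {s})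

attribute [instance] MessageSpace.mM

/-- Message spaces exist over every signal space: `2^S` itself, where a family of subsets is
measurable iff the signals whose singletons belong to it form a measurable set. -/
instance (S : Type) [mS : MeasurableSpace S] : Nonempty (MessageSpace S) :=
  ⟨{ M := Set S
     mM := mS.map (fun s => {s})
     incl := id
     incl_injective := Function.injective_id
     report :=
      letI : MeasurableSpace (Set S) := mS.map (fun s => {s})
      { injective := Set.singleton_injective
        measurable := fun _ hA => hA
        measurableSet_image' := by
          intro A hA
          change MeasurableSet ((fun s : S => ({s} : Set S)) ⁻¹' _)
          have : (fun s : S => ({s} : Set S)) ⁻¹' ((fun s : S => id ({s} : Set S)) '' A) = A :=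
            Set.preimage_image_eq A Set.singleton_injective
          rwa [this] } }⟩

/-! ### Voting -/

/-- Actual acceptance probability of an agent whose rational type accepts with probability `a`. -/
def acceptProb (ε a : ℝ) : ℝ := (1 - ε) * a + ε / 2

/-- Probability that at least `k` of `n` independent votes are acceptances, when agent `i` accepts
with probability `q i`. -/
def launchProb {n : ℕ} (k : ℕ) (q : Fin n → ℝ) : ℝ :=
  ∑ A : Finset (Fin n) with k ≤ A.card, (∏ i ∈ A, q i) * ∏ i ∈ Aᶜ, (1 - q i)

/-! ### Laws and beliefs -/

/-- Joint law of the state and the signal on the event that the project is proposed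
(a measure of total mass `Pr(P = 1)`). -/
def proposalLaw {S : Type} [MeasurableSpace S] (F : Measure State) (π : Kernel State S)
    (γ : S → ℝ) : Measure (State × S) :=
  (F ⊗ₘ π).withDensity (fun p => ENNReal.ofReal (γ p.2))

/-- Joint law of the state and the message (profile) on the event that the project is proposed. -/
def messageLaw {S X : Type} [MeasurableSpace S] [MeasurableSpace X] (F : Measure State)
    (π : Kernel State S) (γ : S → ℝ) (σ : Kernel S X) : Measure (State × X) :=
  (proposalLaw F π γ ⊗ₘ σ.prodMkLeft State).map (fun p => (p.1.1, p.2))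

/-- Bayes' rule: `ψ` disintegrates the (unnormalised) joint law `Q` of an observation in `Y` and an
unknown in `Z`.  This determines `ψ y` at each `y` of positive probability, and leaves it arbitrary
on null sets. -/
def BayesConsistent {Y Z : Type} [MeasurableSpace Y] [MeasurableSpace Z]
    (Q : Measure (Y × Z)) (ψ : Kernel Y Z) : Prop :=
  Q = Q.fst ⊗ₘ ψ

/-! ### The principal's part of an assessment -/

/-- Proposal strategy `γ`, messaging strategy `σ` (with values in message profiles `X`), and the
principal's posterior belief about the state after each signal. -/
structure PrincipalPlan (S X : Type) [MeasurableSpace S] [MeasurableSpace X] where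
  γ : S → ℝ
  γ_measurable : Measurable γ
  γ_mem : ∀ s, γ s ∈ Set.Icc (0 : ℝ) 1
  σ : Kernel S X
  [σ_markov : IsMarkovKernel σ]
  post : Kernel S State
  [post_markov : IsMarkovKernel post]

attribute [instance] PrincipalPlan.σ_markov PrincipalPlan.post_markov

section Principal

variable {n : ℕ} {S X : Type} [MeasurableSpace S] [MeasurableSpace X]

/-- Principal's expected payoff after signal `s` from proposing and sending `x`, when `x` leads to a
launch with probability `ℓ x`. -/
def messagePayoff (G : Game n) (p : PrincipalPlan S X) (ℓ : X → ℝ) (s : S) (x : X) : ℝ :=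
  (∫ θ, G.u θ ∂p.post s) * ℓ x - G.c

/-- Principal's expected payoff after signal `s` from proposing and then following `σ`. -/
def proposePayoff (G : Game n) (p : PrincipalPlan S X) (ℓ : X → ℝ) (s : S) : ℝ :=
  ∫ x, messagePayoff G p ℓ s x ∂p.σ s

/-- Beliefs follow Bayes' rule, and at every signal both the messaging strategy and the proposal
strategy are optimal. -/
structure PrincipalRational (G : Game n) (π : Kernel State S) (p : PrincipalPlan S X)
    (ℓ : X → ℝ) : Prop where
  bayes : BayesConsistent ((G.F ⊗ₘ π).map Prod.swap) p.post
  message_optimal : ∀ s x, messagePayoff G p ℓ s x ≤ proposePayoff G p ℓ s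
  propose_optimal : ∀ s, ∀ g ∈ Set.Icc (0 : ℝ) 1,
    g * proposePayoff G p ℓ s ≤ p.γ s * proposePayoff G p ℓ s

end Principal

/-! ### Public messaging -/

/-- An assessment under public messaging: the principal sends one common message in `M`; rational
agent `i` accepts with probability `τ i m` after message `m`, and then believes `ψ i m`. -/
structure PublicAssessment (n : ℕ) (S M : Type) [MeasurableSpace S] [MeasurableSpace M] where
  principal : PrincipalPlan S M
  τ : Fin n → M → ℝ
  τ_measurable : ∀ i, Measurable (τ i)
  τ_mem : ∀ i m, τ i m ∈ Set.Icc (0 : ℝ) 1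
  ψ : Fin n → Kernel M State
  [ψ_markov : ∀ i, IsMarkovKernel (ψ i)]

attribute [instance] PublicAssessment.ψ_markov

section Public

variable {n : ℕ} {S M : Type} [MeasurableSpace S] [MeasurableSpace M]

/-- Launch probability after a proposal and the public message `m`. -/
def PublicAssessment.launch (G : Game n) (ρ : PublicAssessment n S M) (m : M) : ℝ :=
  launchProb G.k (fun j => acceptProb G.ε (ρ.τ j m))

/-- Expected payoff of rational agent `i` after message `m` from accepting with probability `a`. -/
def PublicAssessment.agentPayoff (G : Game n) (ρ : PublicAssessment n S M) (i : Fin n) (m : M)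
    (a : ℝ) : ℝ :=
  ∫ θ, G.v i θ * launchProb G.k
    (fun j => if j = i then acceptProb G.ε a else acceptProb G.ε (ρ.τ j m)) ∂ρ.ψ i m

/-- Weak perfect Bayesian equilibrium of the continuation game under public messaging. -/
structure IsPublicEquilibrium (G : Game n) (π : Kernel State S) (ρ : PublicAssessment n S M) :
    Prop where
  principal : PrincipalRational G π ρ.principal (ρ.launch G)
  bayes : ∀ i, BayesConsistent
    ((messageLaw G.F π ρ.principal.γ ρ.principal.σ).map Prod.swap) (ρ.ψ i)
  vote_optimal : ∀ i m, ∀ a ∈ Set.Icc (0 : ℝ) 1,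
    ρ.agentPayoff G i m a ≤ ρ.agentPayoff G i m (ρ.τ i m)

end Public

/-! ### Private messaging -/

/-- An assessment under private messaging: the principal sends a message profile in `M^n`; agent `i`
sees only his own message, and his belief `ψ i m` concerns the state and the messages of the other
agents. -/
structure PrivateAssessment (n : ℕ) (S M : Type) [MeasurableSpace S] [MeasurableSpace M] where
  principal : PrincipalPlan S (Fin n → M)
  τ : Fin n → M → ℝ
  τ_measurable : ∀ i, Measurable (τ i)
  τ_mem : ∀ i m, τ i m ∈ Set.Icc (0 : ℝ) 1
  ψ : (i : Fin n) → Kernel M (State × ({j : Fin n // j ≠ i} → M))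
  [ψ_markov : ∀ i, IsMarkovKernel (ψ i)]

attribute [instance] PrivateAssessment.ψ_markov

section Private

variable {n : ℕ} {S M : Type} [MeasurableSpace S] [MeasurableSpace M]

/-- Launch probability after a proposal and the message profile `x`. -/
def PrivateAssessment.launch (G : Game n) (ρ : PrivateAssessment n S M) (x : Fin n → M) : ℝ :=
  launchProb G.k (fun j => acceptProb G.ε (ρ.τ j (x j)))

/-- Expected payoff of rational agent `i` after message `m` from accepting with probability `a`. -/
def PrivateAssessment.agentPayoff (G : Game n) (ρ : PrivateAssessment n S M) (i : Fin n) (m : M)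
    (a : ℝ) : ℝ :=
  ∫ z, G.v i z.1 * launchProb G.k
    (fun j => if h : j = i then acceptProb G.ε a else acceptProb G.ε (ρ.τ j (z.2 ⟨j, h⟩))) ∂ρ.ψ i m

/-- Weak perfect Bayesian equilibrium of the continuation game under private messaging. -/
structure IsPrivateEquilibrium (G : Game n) (π : Kernel State S) (ρ : PrivateAssessment n S M) :
    Prop where
  principal : PrincipalRational G π ρ.principal (ρ.launch G)
  bayes : ∀ i, BayesConsistent
    ((messageLaw G.F π ρ.principal.γ ρ.principal.σ).map
      (fun p => (p.2 i, (p.1, fun j : {j : Fin n // j ≠ i} => p.2 j)))) (ρ.ψ i)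
  vote_optimal : ∀ i m, ∀ a ∈ Set.Icc (0 : ℝ) 1,
    ρ.agentPayoff G i m a ≤ ρ.agentPayoff G i m (ρ.τ i m)

end Private

/-! ### Outcomes and the comparison of the two regimes -/

/-- An outcome: in each state, the probability of a proposal, and the probability of a launch
conditional on a proposal. -/
structure Outcome where
  propose : State → ℝ
  launch : State → ℝ
  propose_mem : ∀ θ, propose θ ∈ Set.Icc (0 : ℝ) 1
  launch_mem : ∀ θ, launch θ ∈ Set.Icc (0 : ℝ) 1

/-- The outcome `ω` is the one generated by the test `π`, the principal's strategy and the launch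
probabilities `ℓ`.  (The conditional launch probability is free in states without proposals.) -/
def Induces {S X : Type} [MeasurableSpace S] [MeasurableSpace X] (π : Kernel State S)
    (p : PrincipalPlan S X) (ℓ : X → ℝ) (ω : Outcome) : Prop :=
  ∀ θ, ω.propose θ = ∫ s, p.γ s ∂π θ ∧
    ω.propose θ * ω.launch θ = ∫ s, p.γ s * ∫ x, ℓ x ∂p.σ s ∂π θ

variable {n : ℕ}

/-- Outcomes implementable given the test `t` under public messaging. -/
def publicOutcomes (G : Game n) (t : Test) (Msg : MessageSpace t.S) : Set Outcome :=
  {ω | ∃ ρ : PublicAssessment n t.S Msg.M,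
    IsPublicEquilibrium G t.π ρ ∧ Induces t.π ρ.principal (ρ.launch G) ω}

/-- Outcomes implementable given the test `t` under private messaging. -/
def privateOutcomes (G : Game n) (t : Test) (Msg : MessageSpace t.S) : Set Outcome :=
  {ω | ∃ ρ : PrivateAssessment n t.S Msg.M,
    IsPrivateEquilibrium G t.π ρ ∧ Induces t.π ρ.principal (ρ.launch G) ω}

/-- The principal's ex ante payoff from an outcome. -/
def principalPayoff (G : Game n) (ω : Outcome) : ℝ :=
  ∫ θ, (G.u θ * ω.launch θ - G.c) * ω.propose θ ∂G.F

/-- Payoffs that the principal can reach under public messaging, over all tests. -/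
def publicPayoffs (G : Game n) (Msg : (S : Type) → [MeasurableSpace S] → MessageSpace S) : Set ℝ :=
  {w | ∃ t : Test, ∃ ω ∈ publicOutcomes G t (Msg t.S), w = principalPayoff G ω}

/-- Payoffs that the principal can reach under private messaging, over all tests. -/
def privatePayoffs (G : Game n) (Msg : (S : Type) → [MeasurableSpace S] → MessageSpace S) : Set ℝ :=
  {w | ∃ t : Test, ∃ ω ∈ privateOutcomes G t (Msg t.S), w = principalPayoff G ω}

/-- The principal's optimal value is strictly higher under public than under private messaging. -/
def PublicStrictlyBetter (G : Game n)
    (Msg : (S : Type) → [MeasurableSpace S] → MessageSpace S) : Prop :=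
  ∃ Vpub Vpri : ℝ, IsLUB (publicPayoffs G Msg) Vpub ∧ IsLUB (privatePayoffs G Msg) Vpri ∧
    Vpri < Vpub

/-! ### The linear environment -/

/-- The game with `u θ = θ` and `v i θ = α i * θ + β i`. -/
def linearGame (k : ℕ) (ε : ℝ) (α β : Fin n → ℝ) (F : Measure State) (c : ℝ) : Game n where
  k := k
  ε := ε
  c := c
  F := F
  u := fun θ => (θ : ℝ)
  v := fun i θ => α i * (θ : ℝ) + β i

/-- Acceptance threshold of agent `i`. -/
def threshold (α β : Fin n → ℝ) (i : Fin n) : ℝ := -β i / α i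

/-- Agents `i` and `j` are the principal's conflicting allies. -/
def ConflictingAllies (α β : Fin n → ℝ) (i j : Fin n) : Prop :=
  i ≠ j ∧ α i = -1 ∧ α j = 1 ∧
    0 < threshold α β i ∧ threshold α β i < threshold α β j ∧ threshold α β j < 1

end Messaging

end

/-! Write `N` and `D` for the integrals of `θ * ω.propose θ` and `ω.propose θ`; given a proposal the
mean state is `N / D`. Since a proposal is costly, the principal proposes only after signals with
positive posterior mean, and then she wants the launch probability to be as large as possible. Hence
all messages that accompany proposals lead to one and the same launch probability `L`, the largest
that any message generates (`PrincipalRational.launchesAt`).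

Under private messaging the message to one agent can be changed while the others are held fixed, and
the launch probability is strictly increasing in each vote because mechanical types make everyone
pivotal with positive probability. So each agent casts a constant vote on path and, if it is
positive, must be willing to accept at the mean `N / D` (`IsPrivateEquilibrium.exists_votes`). Under
public messaging only the total effect of the votes is pinned down: different messages may rally
different supporters, as long as `L` is the same.

Without conflicting allies this freedom is worthless. Take two messages with positive means on
either side of `N / D`. If pooling at `N / D` lost a supporter from each, the one lost from below
would have slope `-1`, the one lost from above slope `1`, and they would be conflicting allies.
Hence pooling secures at least `L` (`IsPublicEquilibrium.le_topVotes`). A larger launch probability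
may tempt the principal to propose where she used to forgo. Then part of the forgone mass is pooled
into the proposal, either until the launch probability can be set to a level `ℓ ≥ L` that makes her
indifferent about the forgone mass, or until she always proposes; her payoff does not fall
(`exists_privatePayoff_ge`).

With conflicting allies `i` and `j`, chosen with adjacent thresholds `x < y`, let the prior put mass
one half on a short interval below `x` and on one above `y`. Publicly disclosing which interval
contains the state wins `i` in one case and `j` in the other, with equal launch probabilities by
symmetry, so she can always propose. Under private messaging a proposal made almost always has a
mean strictly between `x` and `y`, where both allies reject; the loss is bounded away from zero
(`exists_publicStrictlyBetter`). -/

namespace Messaging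

/-! ### Launch probabilities as functions of the votes -/

noncomputable section Voting

variable {n : ℕ}

/-- Probability that the agents in `B` accept and the others, except `i`, reject. -/
def ballotWeight (r : Fin n → ℝ) (i : Fin n) (B : Finset (Fin n)) : ℝ :=
  (∏ j ∈ B, r j) * ∏ j ∈ (insert i B)ᶜ, (1 - r j)

/-- Probability that at least `k` agents other than `i` accept. -/
def launchWithout (k : ℕ) (r : Fin n → ℝ) (i : Fin n) : ℝ :=
  ∑ B ∈ (Finset.univ.erase i).powerset with k ≤ B.card, ballotWeight r i B

/-- Probability that agent `i` is pivotal. -/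
def pivotProb (k : ℕ) (r : Fin n → ℝ) (i : Fin n) : ℝ :=
  ∑ B ∈ (Finset.univ.erase i).powerset with B.card + 1 = k, ballotWeight r i B

/-- Coalitions are paired as `B` and `insert i B` with `i ∉ B`. Both launch if `k ≤ B.card`, only
the second if `B.card + 1 = k`, and neither otherwise; in the first case the weights of `i`
accepting and rejecting add up to one. -/
theorem launchProb_eq (k : ℕ) (q : Fin n → ℝ) (i : Fin n) :
    launchProb k q = launchWithout k q i + q i * pivotProb k q i := by
  have hsplit : ∀ f : Finset (Fin n) → ℝ,
      ∑ A : Finset (Fin n), f A =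
        ∑ B ∈ (Finset.univ.erase i).powerset, (f B + f (insert i B)) := by
    intro f
    have h := Finset.sum_powerset_insert (Finset.notMem_erase i Finset.univ) f
    rw [Finset.insert_erase (Finset.mem_univ i), Finset.powerset_univ] at h
    rw [h, Finset.sum_add_distrib]
  unfold launchProb launchWithout pivotProb
  rw [Finset.sum_filter, hsplit, Finset.sum_filter, Finset.sum_filter, Finset.mul_sum,
    ← Finset.sum_add_distrib]
  refine Finset.sum_congr rfl fun B hB => ?_
  have hi : i ∉ B := fun h => by
    simpa using Finset.mem_powerset.1 hB h
  have hc : Bᶜ = insert i (insert i B)ᶜ := by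
    ext j; by_cases hj : j = i <;> simp [hj, hi]
  have h1 : ∏ j ∈ Bᶜ, (1 - q j) = (1 - q i) * ∏ j ∈ (insert i B)ᶜ, (1 - q j) := by
    rw [hc, Finset.prod_insert (by simp)]
  have h2 : ∏ j ∈ insert i B, q j = q i * ∏ j ∈ B, q j := Finset.prod_insert hi
  rw [h1, h2, Finset.card_insert_of_notMem hi]
  unfold ballotWeight
  by_cases h3 : k ≤ B.card
  · rw [if_pos h3, if_pos (by omega), if_pos h3, if_neg (by omega)]; ring
  · by_cases h4 : B.card + 1 = k
    · rw [if_neg h3, if_pos (by omega), if_neg h3, if_pos h4]; ring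
    · rw [if_neg h3, if_neg (by omega), if_neg h3, if_neg h4]; ring

theorem ballotWeight_congr {r r' : Fin n → ℝ} {i : Fin n} (h : ∀ j, j ≠ i → r j = r' j)
    {B : Finset (Fin n)} (hB : B ∈ (Finset.univ.erase i).powerset) :
    ballotWeight r i B = ballotWeight r' i B := by
  unfold ballotWeight
  congr 1
  · refine Finset.prod_congr rfl fun j hj => h j ?_
    exact Finset.ne_of_mem_erase (Finset.mem_powerset.1 hB hj)
  · refine Finset.prod_congr rfl fun j hj => ?_
    rw [h j]
    rintro rfl
    simp at hj

theorem launchWithout_congr (k : ℕ) {r r' : Fin n → ℝ} {i : Fin n}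
    (h : ∀ j, j ≠ i → r j = r' j) : launchWithout k r i = launchWithout k r' i :=
  Finset.sum_congr rfl fun _ hB => ballotWeight_congr h (Finset.mem_filter.1 hB).1

theorem pivotProb_congr (k : ℕ) {r r' : Fin n → ℝ} {i : Fin n}
    (h : ∀ j, j ≠ i → r j = r' j) : pivotProb k r i = pivotProb k r' i :=
  Finset.sum_congr rfl fun _ hB => ballotWeight_congr h (Finset.mem_filter.1 hB).1

/-- The launch probability is affine in the acceptance probability of each agent. -/
theorem launchProb_of_eq_off (k : ℕ) {q r : Fin n → ℝ} {i : Fin n}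
    (h : ∀ j, j ≠ i → q j = r j) :
    launchProb k q = launchWithout k r i + q i * pivotProb k r i := by
  rw [launchProb_eq k q i, launchWithout_congr k h, pivotProb_congr k h]

theorem ballotWeight_nonneg {r : Fin n → ℝ} (hr : ∀ j, r j ∈ Set.Icc (0 : ℝ) 1) (i : Fin n)
    (B : Finset (Fin n)) : 0 ≤ ballotWeight r i B :=
  mul_nonneg (Finset.prod_nonneg fun j _ => (hr j).1)
    (Finset.prod_nonneg fun j _ => sub_nonneg.2 (hr j).2)

theorem pivotProb_nonneg (k : ℕ) {r : Fin n → ℝ} (hr : ∀ j, r j ∈ Set.Icc (0 : ℝ) 1)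
    (i : Fin n) : 0 ≤ pivotProb k r i :=
  Finset.sum_nonneg fun _ _ => ballotWeight_nonneg hr i _

/-- Interior acceptance probabilities give every coalition positive weight, and some coalition of `k
- 1` other agents exists. This is where mechanical types enter: no vote is ever irrelevant, so
voting optimally means voting by the expected payoff from a launch. -/
theorem pivotProb_pos {k : ℕ} (hk : 1 ≤ k) (hkn : k ≤ n) {r : Fin n → ℝ}
    (hr : ∀ j, r j ∈ Set.Ioo (0 : ℝ) 1) (i : Fin n) : 0 < pivotProb k r i := by
  refine Finset.sum_pos (fun B _ => ?_) ?_
  · exact mul_pos (Finset.prod_pos fun j _ => (hr j).1)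
      (Finset.prod_pos fun j _ => sub_pos.2 (hr j).2)
  · obtain ⟨B, hB, hcard⟩ := Finset.exists_subset_card_eq
      (s := (Finset.univ : Finset (Fin n)).erase i) (n := k - 1)
      (by rw [Finset.card_erase_of_mem (Finset.mem_univ i), Finset.card_fin]; omega)
    exact ⟨B, Finset.mem_filter.2 ⟨Finset.mem_powerset.2 hB, by omega⟩⟩

theorem launchProb_nonneg (k : ℕ) {q : Fin n → ℝ} (hq : ∀ j, q j ∈ Set.Icc (0 : ℝ) 1) :
    0 ≤ launchProb k q :=
  Finset.sum_nonneg fun _ _ => mul_nonneg (Finset.prod_nonneg fun j _ => (hq j).1)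
    (Finset.prod_nonneg fun j _ => sub_nonneg.2 (hq j).2)

theorem launchProb_le_one (k : ℕ) {q : Fin n → ℝ} (hq : ∀ j, q j ∈ Set.Icc (0 : ℝ) 1) :
    launchProb k q ≤ 1 := by
  have h : ∑ A : Finset (Fin n), (∏ i ∈ A, q i) * ∏ i ∈ Aᶜ, (1 - q i) = 1 := by
    have := Finset.prod_add q (fun i => 1 - q i) Finset.univ
    simp only [add_sub_cancel, Finset.prod_const_one, Finset.powerset_univ] at this
    refine Eq.trans ?_ this.symm
    exact Finset.sum_congr rfl fun A _ => by rw [Finset.compl_eq_univ_sdiff]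
  rw [← h]
  exact Finset.sum_le_sum_of_subset_of_nonneg (Finset.filter_subset _ _) fun A _ _ =>
    mul_nonneg (Finset.prod_nonneg fun j _ => (hq j).1)
      (Finset.prod_nonneg fun j _ => sub_nonneg.2 (hq j).2)

theorem launchProb_mono (k : ℕ) {q q' : Fin n → ℝ} (hq : ∀ j, q j ∈ Set.Icc (0 : ℝ) 1)
    (hq' : ∀ j, q' j ∈ Set.Icc (0 : ℝ) 1) (h : ∀ j, q j ≤ q' j) :
    launchProb k q ≤ launchProb k q' := by
  -- Agents are moved from `q` to `q'` one at a time; each move changes an affine function whose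
  -- slope is a pivot probability.
  have key : ∀ T : Finset (Fin n),
      launchProb k q ≤ launchProb k (fun j => if j ∈ T then q' j else q j) := by
    intro T
    induction T using Finset.induction_on with
    | empty => simp
    | insert i T hi ih =>
      refine ih.trans ?_
      set r : Fin n → ℝ := fun j => if j ∈ T then q' j else q j with hr
      have hoff : ∀ j, j ≠ i → (if j ∈ insert i T then q' j else q j) = r j := by
        intro j hj; simp [hr, hj]
      rw [launchProb_of_eq_off k hoff, launchProb_eq k r i]
      have h1 : r i = q i := by simp [hr, hi]
      have h2 : 0 ≤ pivotProb k r i := by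
        refine pivotProb_nonneg k (fun j => ?_) i
        by_cases hj : j ∈ T
        · simpa [hr, hj] using hq' j
        · simpa [hr, hj] using hq j
      have h3 := h i
      simp only [Finset.mem_insert_self, if_true, h1]
      gcongr
  simpa using key Finset.univ

theorem acceptProb_mem_Ioo {ε a : ℝ} (hε : 0 < ε) (hε1 : ε < 1) (ha : a ∈ Set.Icc (0 : ℝ) 1) :
    acceptProb ε a ∈ Set.Ioo (0 : ℝ) 1 := by
  obtain ⟨h0, h1⟩ := ha
  unfold acceptProb
  constructor <;> nlinarith [mul_nonneg (sub_nonneg.2 hε1.le) h0,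
    mul_nonneg (sub_nonneg.2 hε1.le) (sub_nonneg.2 h1)]

theorem acceptProb_mem_Icc {ε a : ℝ} (hε : 0 < ε) (hε1 : ε < 1) (ha : a ∈ Set.Icc (0 : ℝ) 1) :
    acceptProb ε a ∈ Set.Icc (0 : ℝ) 1 :=
  Set.Ioo_subset_Icc_self (acceptProb_mem_Ioo hε hε1 ha)

/-- Launch probability when the rational types accept with probabilities `a`. -/
def rationalLaunch (k : ℕ) (ε : ℝ) (a : Fin n → ℝ) : ℝ :=
  launchProb k (fun j => acceptProb ε (a j))

variable {k : ℕ} {ε : ℝ}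

theorem rationalLaunch_mem (hε : 0 < ε) (hε1 : ε < 1) {a : Fin n → ℝ}
    (ha : ∀ j, a j ∈ Set.Icc (0 : ℝ) 1) : rationalLaunch k ε a ∈ Set.Icc (0 : ℝ) 1 :=
  ⟨launchProb_nonneg k fun j => acceptProb_mem_Icc hε hε1 (ha j),
    launchProb_le_one k fun j => acceptProb_mem_Icc hε hε1 (ha j)⟩

theorem rationalLaunch_mono (hε : 0 < ε) (hε1 : ε < 1) {a b : Fin n → ℝ}
    (ha : ∀ j, a j ∈ Set.Icc (0 : ℝ) 1) (hb : ∀ j, b j ∈ Set.Icc (0 : ℝ) 1)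
    (h : ∀ j, a j ≤ b j) : rationalLaunch k ε a ≤ rationalLaunch k ε b := by
  refine launchProb_mono k (fun j => acceptProb_mem_Icc hε hε1 (ha j))
    (fun j => acceptProb_mem_Icc hε hε1 (hb j)) fun j => ?_
  unfold acceptProb
  have := mul_le_mul_of_nonneg_left (h j) (sub_nonneg.2 hε1.le)
  linarith

/-- Raising the acceptance probability of one agent strictly raises the launch probability. -/
theorem rationalLaunch_lt (hk : 1 ≤ k) (hkn : k ≤ n) (hε : 0 < ε) (hε1 : ε < 1)
    {a b : Fin n → ℝ} (ha : ∀ j, a j ∈ Set.Icc (0 : ℝ) 1) {i : Fin n}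
    (h : ∀ j, j ≠ i → b j = a j) (hi : a i < b i) :
    rationalLaunch k ε a < rationalLaunch k ε b := by
  have hpos := pivotProb_pos hk hkn (fun j => acceptProb_mem_Ioo hε hε1 (ha j)) i
  unfold rationalLaunch
  rw [launchProb_of_eq_off k (q := fun j => acceptProb ε (b j)) (i := i)
    (r := fun j => acceptProb ε (a j)) (fun j hj => by simp only [h j hj]),
    launchProb_eq k _ i]
  have : acceptProb ε (a i) < acceptProb ε (b i) := by
    unfold acceptProb
    have := mul_lt_mul_of_pos_left hi (sub_pos.2 hε1)
    linarith
  gcongr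

theorem continuous_rationalLaunch : Continuous (rationalLaunch (n := n) k ε) := by
  unfold rationalLaunch launchProb acceptProb
  fun_prop

/-- Only the number of acceptances matters. This anonymity lets one ally replace the other without
changing the launch probability. -/
theorem launchProb_comp_perm (k : ℕ) (q : Fin n → ℝ) (e : Equiv.Perm (Fin n)) :
    launchProb k (q ∘ e) = launchProb k q := by
  unfold launchProb
  refine Finset.sum_equiv (Equiv.finsetCongr e) (fun A => by simp) fun A _ => ?_
  simp only [Equiv.finsetCongr_apply, Function.comp_apply, Finset.prod_map, Equiv.coe_toEmbedding]
  congr 1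
  refine (Finset.prod_map Aᶜ e.toEmbedding (fun j => 1 - q j)).symm.trans ?_
  congr 1
  ext j; simp

end Voting

/-! ### Bounded integrals, and integration against Bayes-consistent beliefs -/

section Integrals

theorem integrable_of_abs_le {Ω : Type*} [MeasurableSpace Ω] {μ : Measure Ω} [IsFiniteMeasure μ]
    {f : Ω → ℝ} (hf : Measurable f) {C : ℝ} (hC : ∀ x, |f x| ≤ C) : Integrable f μ :=
  Integrable.of_bound hf.aestronglyMeasurable C (ae_of_all _ fun x => hC x)

theorem abs_integral_le {Ω : Type*} [MeasurableSpace Ω] {μ : Measure Ω} [IsProbabilityMeasure μ]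
    {f : Ω → ℝ} {C : ℝ} (hC : ∀ x, |f x| ≤ C) : |∫ x, f x ∂μ| ≤ C := by
  simpa using norm_integral_le_of_norm_le_const (μ := μ) (f := f) (ae_of_all _ fun x => hC x)

theorem measurable_kernel_integral {Y Z : Type*} [MeasurableSpace Y] [MeasurableSpace Z]
    (κ : Kernel Y Z) [IsSFiniteKernel κ] {f : Z → ℝ} (hf : Measurable f) :
    Measurable fun y => ∫ z, f z ∂κ y :=
  (hf.stronglyMeasurable.integral_kernel).measurable

theorem abs_state_le (θ : State) : |(θ : ℝ)| ≤ 1 := abs_le.2 θ.2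

theorem integrable_state (μ : Measure State) [IsFiniteMeasure μ] :
    Integrable (fun θ : State => (θ : ℝ)) μ :=
  integrable_of_abs_le measurable_subtype_coe abs_state_le

theorem integral_affine_state (μ : Measure State) [IsProbabilityMeasure μ] (a b : ℝ) :
    ∫ θ, (a * (θ : ℝ) + b) ∂μ = a * (∫ θ, (θ : ℝ) ∂μ) + b := by
  rw [integral_add ((integrable_state μ).const_mul a) (integrable_const b), integral_const_mul]
  simp

theorem BayesConsistent.integral_eq {Y Z : Type} [MeasurableSpace Y] [MeasurableSpace Z]
    {Q : Measure (Y × Z)} [IsFiniteMeasure Q] {ψ : Kernel Y Z} [IsMarkovKernel ψ]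
    (h : BayesConsistent Q ψ) {f : Y × Z → ℝ} (hf : Measurable f) {C : ℝ}
    (hC : ∀ q, |f q| ≤ C) : ∫ q, f q ∂Q = ∫ y, ∫ z, f (y, z) ∂ψ y ∂Q.fst := by
  have hi : Integrable f (Q.fst ⊗ₘ ψ) := integrable_of_abs_le hf hC
  rw [← Measure.integral_compProd hi]
  exact congrArg (fun μ => ∫ q, f q ∂μ) h

end Integrals

/-! ### The laws of states, signals and messages on the event of a proposal -/

section Laws

variable {S X : Type} [MeasurableSpace S] [MeasurableSpace X]
  {F : Measure State} [IsProbabilityMeasure F] {π : Kernel State S} [IsMarkovKernel π]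
  {p : PrincipalPlan S X}

theorem PrincipalPlan.abs_γ_le (p : PrincipalPlan S X) (s : S) : |p.γ s| ≤ 1 :=
  abs_le.2 ⟨by linarith [(p.γ_mem s).1], (p.γ_mem s).2⟩

instance isFiniteMeasure_proposalLaw (p : PrincipalPlan S X) :
    IsFiniteMeasure (proposalLaw F π p.γ) := by
  refine isFiniteMeasure_withDensity_ofReal ?_
  exact (integrable_of_abs_le (p.γ_measurable.comp measurable_snd)
    fun q => p.abs_γ_le q.2).2

instance isFiniteMeasure_messageLaw (p : PrincipalPlan S X) :
    IsFiniteMeasure (messageLaw F π p.γ p.σ) := by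
  unfold messageLaw; infer_instance

theorem measurable_messageLaw_map :
    Measurable fun q : (State × S) × X => (q.1.1, q.2) := by fun_prop

theorem integral_messageLaw (p : PrincipalPlan S X) {f : State × X → ℝ} (hf : Measurable f)
    {C : ℝ} (hC : ∀ q, |f q| ≤ C) :
    ∫ q, f q ∂messageLaw F π p.γ p.σ =
      ∫ q, p.γ q.2 * ∫ y, f (q.1, y) ∂p.σ q.2 ∂(F ⊗ₘ π) := by
  unfold messageLaw
  rw [integral_map measurable_messageLaw_map.aemeasurable hf.aestronglyMeasurable,
    Measure.integral_compProd (integrable_of_abs_le (f := fun q : (State × S) × X => f (q.1.1, q.2))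
      (hf.comp measurable_messageLaw_map) fun q => hC _)]
  unfold proposalLaw
  rw [integral_withDensity_eq_integral_toReal_smul
    (f := fun q : State × S => ENNReal.ofReal (p.γ q.2)) (p.γ_measurable.comp measurable_snd).ennreal_ofReal (by simp)]
  refine integral_congr_ae (ae_of_all _ fun q => ?_)
  simp [ENNReal.toReal_ofReal (p.γ_mem q.2).1]

theorem ae_messageLaw (p : PrincipalPlan S X) {P : X → Prop} (hP : MeasurableSet {y | P y})
    (h : ∀ s, 0 < p.γ s → ∀ᵐ y ∂p.σ s, P y) :
    ∀ᵐ q ∂messageLaw F π p.γ p.σ, P q.2 := by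
  unfold messageLaw
  rw [ae_map_iff (p := fun q : State × X => P q.2) measurable_messageLaw_map.aemeasurable
    (measurable_snd hP), Measure.ae_compProd_iff
    (p := fun q : (State × S) × X => P q.2) (measurable_snd hP)]
  unfold proposalLaw
  rw [ae_withDensity_iff (f := fun q : State × S => ENNReal.ofReal (p.γ q.2))
    (p.γ_measurable.comp measurable_snd).ennreal_ofReal]
  refine ae_of_all _ fun q hq => ?_
  have : 0 < p.γ q.2 := by simpa using hq
  simpa using h q.2 this

theorem integral_test {g : State → ℝ} (hg : Measurable g) {φ : S → ℝ} (hφ : Measurable φ)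
    {C D : ℝ} (hC : ∀ θ, |g θ| ≤ C) (hD : ∀ s, |φ s| ≤ D) :
    ∫ q, φ q.2 * g q.1 ∂(F ⊗ₘ π) = ∫ θ, g θ * ∫ s, φ s ∂π θ ∂F := by
  rw [Measure.integral_compProd]
  · refine integral_congr_ae (ae_of_all _ fun θ => ?_)
    simp only [integral_mul_const]
    ring
  · refine integrable_of_abs_le (C := D * C) (by fun_prop) fun q => ?_
    rw [abs_mul]
    exact mul_le_mul (hD _) (hC _) (abs_nonneg _) ((abs_nonneg _).trans (hD q.2))

/-- The tower property: under a weight that depends on the signal alone, the state may be replaced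
by its posterior mean. It turns optimality at each signal into inequalities between integrals over
states. -/
theorem integral_state_posterior
    (h : BayesConsistent ((F ⊗ₘ π).map Prod.swap) p.post) {φ : S → ℝ} (hφ : Measurable φ)
    {C : ℝ} (hC : ∀ s, |φ s| ≤ C) :
    ∫ q, φ q.2 * (q.1 : ℝ) ∂(F ⊗ₘ π) =
      ∫ q, φ q.2 * ∫ θ, (θ : ℝ) ∂p.post q.2 ∂(F ⊗ₘ π) := by
  have hb : ∀ q : S × State, |φ q.1 * (q.2 : ℝ)| ≤ C * 1 := fun q => by
    rw [abs_mul]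
    exact mul_le_mul (hC _) (abs_state_le _) (abs_nonneg _) ((abs_nonneg _).trans (hC q.1))
  have hm : Measurable fun q : S × State => φ q.1 * (q.2 : ℝ) := by fun_prop
  have hx : Measurable fun s => ∫ θ, (θ : ℝ) ∂p.post s :=
    measurable_kernel_integral p.post measurable_subtype_coe
  have := (h.integral_eq hm hb)
  rw [integral_map measurable_swap.aemeasurable hm.aestronglyMeasurable] at this
  simp only [Prod.fst_swap, Prod.snd_swap] at this
  rw [this, Measure.fst, integral_map measurable_fst.aemeasurable,
    integral_map measurable_swap.aemeasurable]
  · simp only [integral_const_mul, Prod.fst_swap]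
  · simp only [integral_const_mul]
    exact ((hφ.mul hx).comp measurable_fst).aestronglyMeasurable
  · simp only [integral_const_mul]
    exact (hφ.mul hx).aestronglyMeasurable

end Laws

/-! ### The principal's optimal behaviour and its integrated consequences -/

section Principal

variable {n : ℕ} {S X : Type} [MeasurableSpace S] [MeasurableSpace X]
  {G : Game n} {π : Kernel State S} {p : PrincipalPlan S X} {ℓ : X → ℝ}

theorem proposePayoff_eq (hu : ∀ θ, G.u θ = θ) (hℓ : Measurable ℓ)
    (hℓ1 : ∀ y, ℓ y ∈ Set.Icc (0 : ℝ) 1) (s : S) :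
    proposePayoff G p ℓ s = (∫ θ, (θ : ℝ) ∂p.post s) * (∫ y, ℓ y ∂p.σ s) - G.c := by
  have hi : Integrable ℓ (p.σ s) := integrable_of_abs_le hℓ (C := 1) fun y =>
    abs_le.2 ⟨by linarith [(hℓ1 y).1], (hℓ1 y).2⟩
  unfold proposePayoff messagePayoff
  rw [integral_sub (hi.const_mul _) (integrable_const _), integral_const_mul]
  simp [hu]

/-- Optimal behaviour of a principal who proposes at some signal: `L` is the largest launch
probability that a message can generate, and it is generated by every message sent along with a
proposal. -/
structure LaunchesAt (G : Game n) (p : PrincipalPlan S X) (ℓ : X → ℝ) (L : ℝ) : Prop where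
  le : ∀ y, ℓ y ≤ L
  attained : ∃ y, ℓ y = L
  ae_eq : ∀ s, 0 < p.γ s → ∀ᵐ y ∂p.σ s, ℓ y = L
  propose : ∀ s, p.γ s * G.c ≤ p.γ s * (L * ∫ θ, (θ : ℝ) ∂p.post s)
  forgo : ∀ s, (1 - p.γ s) * (L * ∫ θ, (θ : ℝ) ∂p.post s) ≤ (1 - p.γ s) * G.c

/-- A proposal pays only if the posterior mean times the launch probability covers `c > 0`, so the
mean is positive. All signals with positive mean rank messages in the same way, by launch
probability, whence one maximum `L` serves all of them. -/
theorem PrincipalRational.launchesAt (h : PrincipalRational G π p ℓ) (hu : ∀ θ, G.u θ = θ)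
    (hc : 0 < G.c) (hℓ : Measurable ℓ) (hℓ1 : ∀ y, ℓ y ∈ Set.Icc (0 : ℝ) 1) :
    (∀ s, p.γ s = 0) ∨ ∃ L, LaunchesAt G p ℓ L := by
  by_cases h0 : ∀ s, p.γ s = 0
  · exact Or.inl h0
  right
  push Not at h0
  obtain ⟨s₀, hs₀⟩ := h0
  have hi : ∀ s, Integrable ℓ (p.σ s) := fun s => integrable_of_abs_le hℓ (C := 1) fun y =>
    abs_le.2 ⟨by linarith [(hℓ1 y).1], (hℓ1 y).2⟩
  have hI0 : ∀ s, 0 ≤ ∫ y, ℓ y ∂p.σ s := fun s => integral_nonneg fun y => (hℓ1 y).1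
  have hpos : ∀ s, 0 < p.γ s →
      G.c ≤ (∫ θ, (θ : ℝ) ∂p.post s) * ∫ y, ℓ y ∂p.σ s := by
    intro s hs
    have := h.propose_optimal s 0 (by simp)
    rw [zero_mul, proposePayoff_eq hu hℓ hℓ1] at this
    linarith [nonneg_of_mul_nonneg_right this hs]
  have hxpos : ∀ s, 0 < p.γ s → 0 < ∫ θ, (θ : ℝ) ∂p.post s := by
    intro s hs
    exact pos_of_mul_pos_left (hc.trans_le (hpos s hs)) (hI0 s)
  have hle : ∀ s, 0 < (∫ θ, (θ : ℝ) ∂p.post s) → ∀ y, ℓ y ≤ ∫ y, ℓ y ∂p.σ s := by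
    intro s hs y
    have := h.message_optimal s y
    rw [proposePayoff_eq hu hℓ hℓ1, messagePayoff] at this
    simp only [hu] at this
    exact le_of_mul_le_mul_left (by linarith) hs
  have hs₀' : 0 < p.γ s₀ := lt_of_le_of_ne (p.γ_mem s₀).1 (Ne.symm hs₀)
  -- Any signal with a proposal may define `L`: it bounds `ℓ` everywhere, and the mixture sent at
  -- any other signal with positive mean has the same average.
  set L := ∫ y, ℓ y ∂p.σ s₀ with hL
  have hLle : ∀ y, ℓ y ≤ L := hle s₀ (hxpos s₀ hs₀')
  have hIle : ∀ s, ∫ y, ℓ y ∂p.σ s ≤ L := fun s => by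
    have := integral_mono (hi s) (integrable_const L) hLle
    simpa using this
  have hIeq : ∀ s, 0 < (∫ θ, (θ : ℝ) ∂p.post s) → ∫ y, ℓ y ∂p.σ s = L := by
    intro s hs
    refine le_antisymm (hIle s) ?_
    have := integral_mono (hi s₀) (integrable_const (∫ y, ℓ y ∂p.σ s)) (hle s hs)
    simpa using this
  have hae : ∀ s, 0 < p.γ s → ∀ᵐ y ∂p.σ s, ℓ y = L := by
    intro s hs
    -- A nonnegative function with integral zero vanishes almost everywhere.
    have h1 : ∫ y, (L - ℓ y) ∂p.σ s = 0 := by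
      rw [integral_sub (integrable_const L) (hi s), hIeq s (hxpos s hs)]; simp
    rw [integral_eq_zero_iff_of_nonneg (fun y => sub_nonneg.2 (hLle y))
      ((integrable_const L).sub (hi s))] at h1
    filter_upwards [h1] with y hy
    have : L - ℓ y = 0 := hy
    linarith
  refine ⟨L, hLle, ?_, hae, fun s => ?_, fun s => ?_⟩
  · exact (hae s₀ hs₀').exists
  · rcases (p.γ_mem s).1.eq_or_lt with h1 | h1
    · simp [← h1]
    · rw [← hIeq s (hxpos s h1), mul_comm (∫ y, ℓ y ∂p.σ s)]
      exact mul_le_mul_of_nonneg_left (hpos s h1) h1.le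
  · rcases (p.γ_mem s).2.eq_or_lt with h1 | h1
    · simp [h1]
    · refine mul_le_mul_of_nonneg_left ?_ (sub_nonneg.2 h1.le)
      rcases lt_or_ge 0 (∫ θ, (θ : ℝ) ∂p.post s) with h2 | h2
      · have := h.propose_optimal s 1 (by simp)
        rw [proposePayoff_eq hu hℓ hℓ1, hIeq s h2] at this
        nlinarith
      · have := mul_nonpos_of_nonneg_of_nonpos (hI0 s₀) h2
        linarith

variable {L : ℝ} {ω : Outcome}

theorem LaunchesAt.propose_mul_launch (h : LaunchesAt G p ℓ L) (hω : Induces π p ℓ ω)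
    (θ : State) : ω.propose θ * ω.launch θ = L * ω.propose θ := by
  rw [(hω θ).2, (hω θ).1, ← integral_const_mul]
  refine integral_congr_ae (ae_of_all _ fun s => ?_)
  rcases (p.γ_mem s).1.eq_or_lt with h1 | h1
  · simp [← h1]
  · have := integral_congr_ae (h.ae_eq s h1)
    simp [this, mul_comm]

theorem abs_propose_le (ω : Outcome) (θ : State) : |ω.propose θ| ≤ 1 :=
  abs_le.2 ⟨by linarith [(ω.propose_mem θ).1], (ω.propose_mem θ).2⟩

variable [IsProbabilityMeasure G.F] [IsMarkovKernel π]

theorem Induces.measurable_propose (hω : Induces π p ℓ ω) : Measurable ω.propose := by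
  rw [funext fun θ => (hω θ).1]
  exact measurable_kernel_integral π p.γ_measurable

theorem LaunchesAt.principalPayoff_eq (h : LaunchesAt G p ℓ L) (hω : Induces π p ℓ ω)
    (hu : ∀ θ, G.u θ = θ) :
    principalPayoff G ω =
      L * (∫ θ, θ * ω.propose θ ∂G.F) - G.c * ∫ θ, ω.propose θ ∂G.F := by
  have hm := hω.measurable_propose
  unfold principalPayoff
  rw [← integral_const_mul, ← integral_const_mul, ← integral_sub]
  · refine integral_congr_ae (ae_of_all _ fun θ => ?_)
    have := h.propose_mul_launch hω θ
    simp only [hu]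
    linear_combination (θ : ℝ) * this
  · refine (integrable_of_abs_le (by fun_prop) (C := 1) fun θ => ?_).const_mul L
    rw [abs_mul]
    exact mul_le_one₀ (abs_state_le θ) (abs_nonneg _) (abs_propose_le ω θ)
  · exact (integrable_of_abs_le hm (abs_propose_le ω)).const_mul _

theorem Induces.integral_mul_propose (hω : Induces π p ℓ ω) {g : State → ℝ} (hg : Measurable g)
    {C : ℝ} (hC : ∀ θ, |g θ| ≤ C) :
    ∫ q, g q.1 ∂messageLaw G.F π p.γ p.σ = ∫ θ, g θ * ω.propose θ ∂G.F := by
  rw [integral_messageLaw p (f := fun q => g q.1) (hg.comp measurable_fst) (fun q => hC _)]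
  simp only [integral_const, probReal_univ, one_smul]
  rw [integral_test hg p.γ_measurable hC p.abs_γ_le]
  exact integral_congr_ae (ae_of_all _ fun θ => by simp only [(hω θ).1])

/-- Integrating the `forgo` inequalities over signals: on the forgone mass as a whole, proposing
does not pay at launch probability `L`. In this form the constraint can be compared with that of
another test. -/
theorem LaunchesAt.forgo_le (h : LaunchesAt G p ℓ L) (hω : Induces π p ℓ ω)
    (hb : BayesConsistent ((G.F ⊗ₘ π).map Prod.swap) p.post) :
    L * (∫ θ, θ * (1 - ω.propose θ) ∂G.F) ≤ G.c * ∫ θ, (1 - ω.propose θ) ∂G.F := by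
  have hφ : Measurable fun s => 1 - p.γ s := measurable_const.sub p.γ_measurable
  have hφ1 : ∀ s, |1 - p.γ s| ≤ 1 := fun s =>
    abs_le.2 ⟨by linarith [(p.γ_mem s).2], by linarith [(p.γ_mem s).1]⟩
  have hint : ∀ θ, ∫ s, (1 - p.γ s) ∂π θ = 1 - ω.propose θ := fun θ => by
    rw [integral_sub (integrable_const _) (integrable_of_abs_le p.γ_measurable p.abs_γ_le),
      (hω θ).1]
    simp
  have hx : Measurable fun s => ∫ θ, (θ : ℝ) ∂p.post s :=
    measurable_kernel_integral p.post measurable_subtype_coe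
  have hx1 : ∀ s, |∫ θ, (θ : ℝ) ∂p.post s| ≤ 1 := fun s => abs_integral_le abs_state_le
  have h1 := integral_test (F := G.F) (π := π) measurable_subtype_coe hφ abs_state_le hφ1
  have h2 := integral_test (F := G.F) (π := π) (g := fun _ => 1) measurable_const hφ
    (C := 1) (by simp) hφ1
  simp only [hint, mul_one, one_mul] at h1 h2
  rw [← h1, ← h2, integral_state_posterior hb hφ hφ1, ← integral_const_mul,
    ← integral_const_mul]
  refine integral_mono ?_ ?_ fun q => ?_
  · refine Integrable.const_mul (integrable_of_abs_le ((hφ.mul hx).comp measurable_snd)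
      (C := 1) fun q => ?_) L
    simp only [Function.comp, Pi.mul_apply]
    rw [abs_mul]
    exact mul_le_one₀ (hφ1 _) (abs_nonneg _) (hx1 _)
  · exact (integrable_of_abs_le (hφ.comp measurable_snd) (fun q => hφ1 q.2)).const_mul _
  · have := h.forgo q.2
    simp only
    linarith

theorem LaunchesAt.ae_messageLaw (h : LaunchesAt G p ℓ L) (hℓ : Measurable ℓ) :
    ∀ᵐ q ∂messageLaw G.F π p.γ p.σ, ℓ q.2 = L :=
  Messaging.ae_messageLaw p (hℓ (measurableSet_singleton L)) h.ae_eq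

/-- Every set of messages that is sent with positive probability together with a proposal is good
news for the principal. -/
theorem LaunchesAt.cost_le (h : LaunchesAt G p ℓ L)
    (hb : BayesConsistent ((G.F ⊗ₘ π).map Prod.swap) p.post) {φ : X → ℝ} (hφ : Measurable φ)
    (hφ1 : ∀ y, φ y ∈ Set.Icc (0 : ℝ) 1) :
    G.c * ∫ q, φ q.2 ∂messageLaw G.F π p.γ p.σ ≤
      L * ∫ q, φ q.2 * (q.1 : ℝ) ∂messageLaw G.F π p.γ p.σ := by
  have hφa : ∀ y, |φ y| ≤ 1 := fun y => abs_le.2 ⟨by linarith [(hφ1 y).1], (hφ1 y).2⟩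
  have hΦ : Measurable fun s => ∫ y, φ y ∂p.σ s := measurable_kernel_integral p.σ hφ
  have hγ := p.γ_measurable
  have hx : Measurable fun s => ∫ θ, (θ : ℝ) ∂p.post s :=
    measurable_kernel_integral p.post measurable_subtype_coe
  have hx1 : ∀ s, |∫ θ, (θ : ℝ) ∂p.post s| ≤ 1 := fun s => abs_integral_le abs_state_le
  have hΦ1 : ∀ s, |∫ y, φ y ∂p.σ s| ≤ 1 := fun s => abs_integral_le hφa
  have hγΦ : ∀ s, |p.γ s * ∫ y, φ y ∂p.σ s| ≤ 1 := fun s => by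
    rw [abs_mul]
    exact mul_le_one₀ (p.abs_γ_le s) (abs_nonneg _) (hΦ1 s)
  rw [integral_messageLaw p (f := fun q => φ q.2) (by fun_prop) (fun q => hφa q.2),
    integral_messageLaw p (f := fun q => φ q.2 * (q.1 : ℝ)) (C := 1) (by fun_prop)
      (fun q => by rw [abs_mul]; exact mul_le_one₀ (hφa _) (abs_nonneg _) (abs_state_le _))]
  simp only [integral_mul_const, ← mul_assoc]
  rw [integral_state_posterior (φ := fun s => p.γ s * ∫ y, φ y ∂p.σ s) hb
    (hγ.mul hΦ) hγΦ, ← integral_const_mul, ← integral_const_mul]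
  refine integral_mono ?_ ?_ fun q => ?_
  · exact (integrable_of_abs_le ((hγ.mul hΦ).comp measurable_snd)
      (fun q => hγΦ q.2)).const_mul _
  · refine Integrable.const_mul (integrable_of_abs_le
      (((hγ.mul hΦ).mul hx).comp measurable_snd) (C := 1) fun q => ?_) L
    simp only [Function.comp, Pi.mul_apply]
    rw [abs_mul]
    exact mul_le_one₀ (hγΦ _) (abs_nonneg _) (hx1 _)
  · have h1 := h.propose q.2
    have h2 : 0 ≤ ∫ y, φ y ∂p.σ q.2 := integral_nonneg fun y => (hφ1 y).1
    have := mul_le_mul_of_nonneg_right h1 h2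
    simp only
    linarith

end Principal

/-! ### Optimal votes -/

section Votes

/-- `t` is an optimal acceptance probability for an agent who expects the payoff `V` from a
launch. -/
def BestVote (V t : ℝ) : Prop := (0 < t → 0 ≤ V) ∧ (t < 1 → V ≤ 0)

/-- The payoff is affine in the agent's own acceptance probability with slope `(1 - ε) * P * V`,
which has the sign of `V`. -/
theorem bestVote_iff {ε V B P t : ℝ} (hε1 : ε < 1) (hP : 0 < P) (ht : t ∈ Set.Icc (0 : ℝ) 1) :
    (∀ a ∈ Set.Icc (0 : ℝ) 1,
      V * (B + acceptProb ε a * P) ≤ V * (B + acceptProb ε t * P)) ↔ BestVote V t := by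
  have hpos : 0 < (1 - ε) * P := mul_pos (sub_pos.2 hε1) hP
  have hdiff : ∀ a, V * (B + acceptProb ε t * P) - V * (B + acceptProb ε a * P) =
      ((1 - ε) * P) * (V * (t - a)) := fun a => by unfold acceptProb; ring
  have hiff : ∀ a, V * (B + acceptProb ε a * P) ≤ V * (B + acceptProb ε t * P) ↔
      0 ≤ V * (t - a) := fun a => by
    rw [← sub_nonneg, hdiff, mul_nonneg_iff_of_pos_left hpos]
  simp only [hiff]
  constructor
  · intro h
    refine ⟨fun h0 => ?_, fun h1 => ?_⟩
    · have := h 0 (by simp)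
      exact nonneg_of_mul_nonneg_left this (by linarith)
    · have := h 1 (by simp)
      by_contra hV
      push Not at hV
      nlinarith
  · rintro ⟨h0, h1⟩ a ha
    rcases ht.1.eq_or_lt with h | h
    · have := h1 (by linarith)
      exact mul_nonneg_of_nonpos_of_nonpos this (by linarith [ha.1])
    · rcases ht.2.eq_or_lt with h' | h'
      · exact mul_nonneg (h0 h) (by linarith [ha.2])
      · rw [le_antisymm (h1 h') (h0 h)]; simp

theorem measurable_rationalLaunch {n k : ℕ} {ε : ℝ} {Y : Type*} [MeasurableSpace Y]
    {f : Fin n → Y → ℝ} (hf : ∀ i, Measurable (f i)) :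
    Measurable fun y => rationalLaunch k ε fun j => f j y :=
  continuous_rationalLaunch.measurable.comp (measurable_pi_lambda _ hf)

theorem abs_affine_state_le (a b : ℝ) (θ : State) : |a * (θ : ℝ) + b| ≤ |a| + |b| := by
  refine (abs_add_le _ _).trans (add_le_add_left ?_ _)
  rw [abs_mul]
  exact mul_le_of_le_one_right (abs_nonneg a) (abs_state_le θ)

end Votes

/-! ### Private messaging: constant votes on path -/

section PrivateEquilibrium

variable {n k : ℕ} {ε c : ℝ} {α β : Fin n → ℝ} {F : Measure State}
  {S M : Type} [MeasurableSpace S] [MeasurableSpace M] {π : Kernel State S}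

/-- In general the state and the other agents' votes are correlated. Once those votes are almost
surely constant, the expected payoff splits into the mean launch payoff times a launch probability
affine in the agent's own vote. -/
theorem PrivateAssessment.agentPayoff_eq {ρ : PrivateAssessment n S M} {i : Fin n} {m : M}
    {a : Fin n → ℝ} (t : ℝ)
    (h : ∀ᵐ z ∂ρ.ψ i m, ∀ j : {j : Fin n // j ≠ i}, ρ.τ j (z.2 j) = a j) :
    ρ.agentPayoff (linearGame k ε α β F c) i m t =
      (∫ z, (α i * (z.1 : ℝ) + β i) ∂ρ.ψ i m) *
        (launchWithout k (fun j => acceptProb ε (a j)) i +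
          acceptProb ε t * pivotProb k (fun j => acceptProb ε (a j)) i) := by
  unfold PrivateAssessment.agentPayoff
  rw [← integral_mul_const]
  refine integral_congr_ae ?_
  filter_upwards [h] with z hz
  simp only [linearGame]
  rw [launchProb_of_eq_off k (r := fun j => acceptProb ε (a j)) (i := i)]
  · simp
  · intro j hj
    simp only [dif_neg hj]
    rw [hz ⟨j, hj⟩]

theorem PrivateAssessment.measurable_launch (ρ : PrivateAssessment n S M) :
    Measurable (ρ.launch (linearGame k ε α β F c)) :=
  measurable_rationalLaunch (k := k) (ε := ε) (f := fun j (x : Fin n → M) => ρ.τ j (x j))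
    fun j => (ρ.τ_measurable j).comp (measurable_pi_apply j)

variable [IsProbabilityMeasure F] [IsMarkovKernel π] {ω : Outcome}

/-- Under private messaging every agent votes in the same way after all messages that he may
receive along with a proposal. -/
theorem IsPrivateEquilibrium.exists_votes (hk : 1 ≤ k) (hkn : k ≤ n) (hε : 0 < ε) (hε1 : ε < 1)
    (hc : 0 < c) {ρ : PrivateAssessment n S M}
    (h : IsPrivateEquilibrium (linearGame k ε α β F c) π ρ)
    (hω : Induces π ρ.principal (ρ.launch (linearGame k ε α β F c)) ω) :
    (∀ θ, ω.propose θ = 0) ∨ ∃ a : Fin n → ℝ, (∀ i, a i ∈ Set.Icc (0 : ℝ) 1) ∧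
      LaunchesAt (linearGame k ε α β F c) ρ.principal (ρ.launch (linearGame k ε α β F c))
        (rationalLaunch k ε a) ∧
      ∀ i, 0 < a i →
        0 ≤ α i * (∫ θ, θ * ω.propose θ ∂F) + β i * ∫ θ, ω.propose θ ∂F := by
  set G := linearGame k ε α β F c with hG
  have : IsProbabilityMeasure G.F := ‹IsProbabilityMeasure F›
  have hlaunch : ∀ x, ρ.launch G x = rationalLaunch k ε fun j => ρ.τ j (x j) := fun _ => rfl
  have hmem : ∀ x, ρ.launch G x ∈ Set.Icc (0 : ℝ) 1 := fun x =>
    rationalLaunch_mem hε hε1 fun j => ρ.τ_mem j _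
  rcases h.principal.launchesAt (fun _ => rfl) hc ρ.measurable_launch hmem with h0 | ⟨L, hL⟩
  · left
    intro θ
    rw [(hω θ).1]
    simp [h0]
  right
  obtain ⟨y₀, hy₀⟩ := hL.attained
  set a : Fin n → ℝ := fun j => ρ.τ j (y₀ j) with ha
  have ha1 : ∀ i, a i ∈ Set.Icc (0 : ℝ) 1 := fun i => ρ.τ_mem i _
  have hLa : L = rationalLaunch k ε a := by rw [← hy₀, hlaunch]
  -- Here privacy is used: a deviation changes the message of agent `i` alone, so a message that
  -- raised his vote would raise the launch probability above its maximum.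
  have hmax : ∀ y i, ρ.launch G y = L → ∀ m, ρ.τ i m ≤ ρ.τ i (y i) := by
    intro y i hy m
    by_contra hlt
    push Not at hlt
    have h1 := hL.le (Function.update y i m)
    rw [← hy, hlaunch, hlaunch] at h1
    refine absurd h1 (not_le.2 (rationalLaunch_lt hk hkn hε hε1 (i := i)
      (fun j => ρ.τ_mem j _) (fun j hj => ?_) ?_))
    · simp [Function.update_of_ne hj]
    · simpa using hlt
  have hsame : ∀ y, ρ.launch G y = L → ∀ i, ρ.τ i (y i) = a i := fun y hy i =>
    le_antisymm (hmax y₀ i hy₀ _) (hmax y i hy _)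
  refine ⟨a, ha1, hLa ▸ hL, fun i hi => ?_⟩
  set Qm := messageLaw G.F π ρ.principal.γ ρ.principal.σ with hQm
  set ζ : State × (Fin n → M) → M × (State × ({j : Fin n // j ≠ i} → M)) :=
    fun p => (p.2 i, (p.1, fun j => p.2 j)) with hζ
  have hζm : Measurable ζ := by fun_prop
  have hb : BayesConsistent (Qm.map ζ) (ρ.ψ i) := h.bayes i
  have hae : ∀ᵐ q ∂(Qm.map ζ), ρ.τ i q.1 = a i ∧
      ∀ j : {j : Fin n // j ≠ i}, ρ.τ j (q.2.2 j) = a j := by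
    rw [ae_map_iff hζm.aemeasurable]
    · filter_upwards [hL.ae_messageLaw (π := π) ρ.measurable_launch] with q hq
      exact ⟨hsame _ hq i, fun j => hsame _ hq j⟩
    · rw [Set.ofPred_and, Set.ofPred_forall]
      refine MeasurableSet.inter ?_ (MeasurableSet.iInter fun j => ?_)
      · exact ((ρ.τ_measurable i).comp measurable_fst) (measurableSet_singleton (a i))
      · exact ((ρ.τ_measurable j).comp (by fun_prop)) (measurableSet_singleton (a j))
  rw [hb] at hae
  -- After almost every message agent `i` casts the vote `a i > 0`, so he cannot expect a negative
  -- launch payoff. Averaging over his messages gives the inequality in terms of the outcome.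
  have hvote : ∀ᵐ m ∂(Qm.map ζ).fst, 0 ≤ ∫ z, (α i * (z.1 : ℝ) + β i) ∂ρ.ψ i m := by
    filter_upwards [Measure.ae_ae_of_ae_compProd hae] with m hm
    have hm1 : ρ.τ i m = a i := (hm.exists.choose_spec).1
    have hm2 : ∀ᵐ z ∂ρ.ψ i m, ∀ j : {j : Fin n // j ≠ i}, ρ.τ j (z.2 j) = a j :=
      hm.mono fun z hz => hz.2
    have hopt := h.vote_optimal i m
    simp only [hG, PrivateAssessment.agentPayoff_eq _ hm2] at hopt
    exact ((bestVote_iff hε1 (pivotProb_pos hk hkn (fun j => acceptProb_mem_Ioo hε hε1 (ha1 j)) i)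
      (ρ.τ_mem i m)).1 hopt).1 (hm1 ▸ hi)
  have hvm : Measurable fun q : M × (State × ({j : Fin n // j ≠ i} → M)) =>
      α i * (q.2.1 : ℝ) + β i := by fun_prop
  have hint := hb.integral_eq hvm (fun q => abs_affine_state_le (α i) (β i) q.2.1)
  rw [integral_map hζm.aemeasurable hvm.aestronglyMeasurable] at hint
  have hnn : 0 ≤ ∫ q, (α i * (q.1 : ℝ) + β i) ∂Qm := by
    rw [hint]
    exact integral_nonneg_of_ae hvote
  rw [hω.integral_mul_propose (G := G) (g := fun θ => α i * (θ : ℝ) + β i) (by fun_prop)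
    (fun θ => abs_affine_state_le (α i) (β i) θ)] at hnn
  have hm := hω.measurable_propose
  rw [← integral_const_mul, ← integral_const_mul, ← integral_add]
  · refine hnn.trans_eq (integral_congr_ae (ae_of_all _ fun θ => ?_))
    simp only
    ring
  · refine (integrable_of_abs_le (by fun_prop) (C := 1) fun θ => ?_).const_mul _
    rw [abs_mul]
    exact mul_le_one₀ (abs_state_le θ) (abs_nonneg _) (abs_propose_le ω θ)
  · exact (integrable_of_abs_le hm (abs_propose_le ω)).const_mul _

end PrivateEquilibrium

/-! ### Public messaging: what pooling can preserve without conflicting allies -/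

section PublicEquilibrium

variable {n k : ℕ} {ε c : ℝ} {α β : Fin n → ℝ} {F : Measure State}
  {S M : Type} [MeasurableSpace S] [MeasurableSpace M] {π : Kernel State S}

theorem PublicAssessment.agentPayoff_eq (ρ : PublicAssessment n S M) (i : Fin n) (m : M)
    (t : ℝ) :
    ρ.agentPayoff (linearGame k ε α β F c) i m t =
      (α i * (∫ θ, (θ : ℝ) ∂ρ.ψ i m) + β i) *
        (launchWithout k (fun j => acceptProb ε (ρ.τ j m)) i +
          acceptProb ε t * pivotProb k (fun j => acceptProb ε (ρ.τ j m)) i) := by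
  unfold PublicAssessment.agentPayoff
  rw [← integral_affine_state, ← integral_mul_const]
  refine integral_congr_ae (ae_of_all _ fun θ => ?_)
  simp only [linearGame]
  rw [launchProb_of_eq_off k (r := fun j => acceptProb ε (ρ.τ j m)) (i := i)]
  · simp
  · intro j hj
    simp [hj]

theorem PublicAssessment.vote_optimal_iff (hk : 1 ≤ k) (hkn : k ≤ n) (hε : 0 < ε) (hε1 : ε < 1)
    (ρ : PublicAssessment n S M) (i : Fin n) (m : M) :
    (∀ a ∈ Set.Icc (0 : ℝ) 1, ρ.agentPayoff (linearGame k ε α β F c) i m a ≤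
      ρ.agentPayoff (linearGame k ε α β F c) i m (ρ.τ i m)) ↔
    BestVote (α i * (∫ θ, (θ : ℝ) ∂ρ.ψ i m) + β i) (ρ.τ i m) := by
  simp only [PublicAssessment.agentPayoff_eq]
  exact bestVote_iff hε1
    (pivotProb_pos hk hkn (fun j => acceptProb_mem_Ioo hε hε1 (ρ.τ_mem j m)) i) (ρ.τ_mem i m)

theorem PublicAssessment.measurable_launch (ρ : PublicAssessment n S M) :
    Measurable (ρ.launch (linearGame k ε α β F c)) :=
  measurable_rationalLaunch (k := k) (ε := ε) ρ.τ_measurable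

open Classical in
/-- The votes of agents who believe that the mean state is `μ` and accept when indifferent. -/
noncomputable def topVotes (α β : Fin n → ℝ) (μ : ℝ) (i : Fin n) : ℝ :=
  if 0 ≤ α i * μ + β i then 1 else 0

theorem topVotes_mem (α β : Fin n → ℝ) (μ : ℝ) (i : Fin n) :
    topVotes α β μ i ∈ Set.Icc (0 : ℝ) 1 := by
  unfold topVotes; split_ifs <;> simp

theorem le_topVotes {a : Fin n → ℝ} (ha : ∀ i, a i ∈ Set.Icc (0 : ℝ) 1) {μ : ℝ} {i : Fin n}
    (h : 0 < a i → 0 ≤ α i * μ + β i) : a i ≤ topVotes α β μ i := by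
  unfold topVotes
  split_ifs with h1
  · exact (ha i).2
  · by_contra h2
    exact h1 (h (not_le.1 h2))

/-- Without conflicting allies, pooling two good news cannot hurt the prospects of a launch. -/
theorem rationalLaunch_le_topVotes (hε : 0 < ε) (hε1 : ε < 1)
    (hα : ∀ i, α i = -1 ∨ α i = 1) (hβ : ∀ i, β i ∈ Set.Ioo (-1 : ℝ) 1)
    (hno : ¬∃ i j : Fin n, ConflictingAllies α β i j) {a₁ a₂ : Fin n → ℝ} {μ₁ μ₂ μ L : ℝ}
    (ha₁ : ∀ i, a₁ i ∈ Set.Icc (0 : ℝ) 1) (ha₂ : ∀ i, a₂ i ∈ Set.Icc (0 : ℝ) 1)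
    (h₁ : ∀ i, 0 < a₁ i → 0 ≤ α i * μ₁ + β i) (h₂ : ∀ i, 0 < a₂ i → 0 ≤ α i * μ₂ + β i)
    (hμ₁ : 0 < μ₁) (hle₁ : μ₁ ≤ μ) (hle₂ : μ ≤ μ₂)
    (hL₁ : rationalLaunch k ε a₁ = L) (hL₂ : rationalLaunch k ε a₂ = L) :
    L ≤ rationalLaunch k ε (topVotes α β μ) := by
  by_cases hA : ∀ i, 0 < a₁ i → 0 ≤ α i * μ + β i
  · rw [← hL₁]
    exact rationalLaunch_mono hε hε1 ha₁ (topVotes_mem α β μ) fun i => le_topVotes ha₁ (hA i)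
  by_cases hB : ∀ i, 0 < a₂ i → 0 ≤ α i * μ + β i
  · rw [← hL₂]
    exact rationalLaunch_mono hε hε1 ha₂ (topVotes_mem α β μ) fun i => le_topVotes ha₂ (hB i)
  exfalso
  -- Agent `i` supports at `μ₁` but not at `μ ≥ μ₁`, so his slope is `-1`; agent `j` supports at
  -- `μ₂` but not at `μ ≤ μ₂`, so his is `1`. Their thresholds then satisfy `0 < μ₁ ≤ δ i < μ < δ
  -- j`.
  push Not at hA hB
  obtain ⟨i, hi, hi'⟩ := hA
  obtain ⟨j, hj, hj'⟩ := hB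
  have h1 := h₁ i hi
  have h2 := h₂ j hj
  have hαi : α i = -1 := (hα i).resolve_right fun h => by rw [h] at h1 hi'; linarith
  have hαj : α j = 1 := (hα j).resolve_left fun h => by rw [h] at h2 hj'; linarith
  rw [hαi] at h1 hi'
  rw [hαj] at h2 hj'
  refine hno ⟨i, j, fun h => ?_, hαi, hαj, ?_, ?_, ?_⟩
  · rw [h, hαj] at hαi; norm_num at hαi
  all_goals simp only [threshold, hαi, hαj, div_neg, div_one, neg_neg]
  · linarith
  · linarith
  · linarith [(hβ j).1]

variable {ω : Outcome}

theorem IsPublicEquilibrium.launchesAt (hε : 0 < ε) (hε1 : ε < 1)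
    (hc : 0 < c) {ρ : PublicAssessment n S M}
    (h : IsPublicEquilibrium (linearGame k ε α β F c) π ρ)
    (hω : Induces π ρ.principal (ρ.launch (linearGame k ε α β F c)) ω) :
    (∀ θ, ω.propose θ = 0) ∨ ∃ L,
      LaunchesAt (linearGame k ε α β F c) ρ.principal (ρ.launch (linearGame k ε α β F c)) L := by
  have hmem : ∀ x, ρ.launch (linearGame k ε α β F c) x ∈ Set.Icc (0 : ℝ) 1 := fun x =>
    rationalLaunch_mem hε hε1 fun j => ρ.τ_mem j _
  refine (h.principal.launchesAt (fun _ => rfl) hc ρ.measurable_launch hmem).imp_left ?_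
  intro h0 θ
  rw [(hω θ).1]
  simp [h0]

variable [IsProbabilityMeasure F] [IsMarkovKernel π]

/-- The mean state conditional on a proposal is the average over messages of the agents' common
posterior mean. Some typical message lies weakly below this average and some weakly above; both are
good news and both yield `L`, so `rationalLaunch_le_topVotes` applies to the pair. -/
theorem IsPublicEquilibrium.le_topVotes (hn : 0 < n) (hk : 1 ≤ k) (hkn : k ≤ n)
    (hε : 0 < ε) (hε1 : ε < 1) (hc : 0 < c)
    (hα : ∀ i, α i = -1 ∨ α i = 1) (hβ : ∀ i, β i ∈ Set.Ioo (-1 : ℝ) 1)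
    (hno : ¬∃ i j : Fin n, ConflictingAllies α β i j) {ρ : PublicAssessment n S M}
    (h : IsPublicEquilibrium (linearGame k ε α β F c) π ρ)
    (hω : Induces π ρ.principal (ρ.launch (linearGame k ε α β F c)) ω) {L : ℝ}
    (hL : LaunchesAt (linearGame k ε α β F c) ρ.principal
      (ρ.launch (linearGame k ε α β F c)) L)
    (hpos : 0 < ∫ θ, ω.propose θ ∂F) :
    L ≤ rationalLaunch k ε
      (topVotes α β ((∫ θ, θ * ω.propose θ ∂F) / ∫ θ, ω.propose θ ∂F)) := by
  set G := linearGame k ε α β F c with hG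
  have : IsProbabilityMeasure G.F := ‹IsProbabilityMeasure F›
  set Qm := messageLaw G.F π ρ.principal.γ ρ.principal.σ with hQm
  set ν : Measure M := (Qm.map Prod.swap).fst with hν
  set e : Fin n → M → ℝ := fun i m => ∫ θ, (θ : ℝ) ∂ρ.ψ i m with he
  have hem : ∀ i, Measurable (e i) := fun i =>
    measurable_kernel_integral (ρ.ψ i) measurable_subtype_coe
  have he1 : ∀ i m, |e i m| ≤ 1 := fun i m => abs_integral_le abs_state_le
  have hei : ∀ i, Integrable (e i) ν := fun i => integrable_of_abs_le (hem i) (he1 i)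
  have hνint : ∀ {f : M → ℝ}, Measurable f → ∫ m, f m ∂ν = ∫ q, f q.2 ∂Qm := by
    intro f hf
    rw [hν, Measure.fst, integral_map measurable_fst.aemeasurable hf.aestronglyMeasurable,
      integral_map (f := fun q : M × State => f q.1) measurable_swap.aemeasurable
        (hf.comp measurable_fst).aestronglyMeasurable]
    rfl
  have hνae : ∀ {P : M → Prop}, MeasurableSet {m | P m} → (∀ᵐ q ∂Qm, P q.2) → ∀ᵐ m ∂ν, P m := by
    intro P hP hq
    rw [hν, Measure.fst, ae_map_iff measurable_fst.aemeasurable hP,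
      ae_map_iff (p := fun q : M × State => P q.1) measurable_swap.aemeasurable
        (measurable_fst hP)]
    exact hq
  have hbelief : ∀ i {φ : M → ℝ}, Measurable φ → (∀ m, |φ m| ≤ 1) →
      ∫ q, φ q.2 * (q.1 : ℝ) ∂Qm = ∫ m, φ m * e i m ∂ν := by
    intro i φ hφ hφ1
    have hm : Measurable fun q : M × State => φ q.1 * (q.2 : ℝ) := by fun_prop
    have := (h.bayes i).integral_eq hm (C := 1) fun q => by
      rw [abs_mul]
      exact mul_le_one₀ (hφ1 _) (abs_nonneg _) (abs_state_le _)
    rw [integral_map measurable_swap.aemeasurable hm.aestronglyMeasurable] at this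
    simp only [Prod.fst_swap, Prod.snd_swap, integral_const_mul] at this
    exact this
  have hset : ∀ i {B : Set M}, MeasurableSet B →
      ∫ m in B, e i m ∂ν = ∫ q, B.indicator (fun _ => (1 : ℝ)) q.2 * (q.1 : ℝ) ∂Qm := by
    intro i B hB
    rw [hbelief i (measurable_const.indicator hB) fun m => ?_, ← integral_indicator hB]
    · refine integral_congr_ae (ae_of_all _ fun m => ?_)
      by_cases hm : m ∈ B <;> simp [hm]
    · by_cases hm : m ∈ B <;> simp [hm]
  let i₀ : Fin n := ⟨0, hn⟩
  -- Beliefs may differ across agents on null sets only, since all of them disintegrate the same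
  -- law.
  have hagree : ∀ i, e i =ᵐ[ν] e i₀ := fun i =>
    Integrable.ae_eq_of_forall_setIntegral_eq _ _ (hei i) (hei i₀) fun B hB _ => by
      rw [hset i hB, hset i₀ hB]
  -- Indicators of measurable sets of messages in `cost_le` turn the principal's willingness to
  -- propose into an almost sure bound; with `L ≥ 0` it makes posterior means positive.
  have hgood : (fun _ => c) ≤ᵐ[ν] fun m => L * e i₀ m := by
    refine ae_le_of_forall_setIntegral_le (integrable_const c) ((hei i₀).const_mul L)
      fun B hB _ => ?_
    have h1 := hL.cost_le (π := π) h.principal.bayes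
      (φ := B.indicator fun _ => (1 : ℝ)) (measurable_const.indicator hB) fun m => by
        by_cases hm : m ∈ B <;> simp [hm]
    rw [integral_const_mul, hset i₀ hB]
    refine le_trans (le_of_eq ?_) h1
    rw [← hνint (measurable_const.indicator hB), integral_indicator hB, ← integral_const_mul]
    simp [hG, linearGame]
  have hL0 : 0 ≤ L := by
    obtain ⟨y, hy⟩ := hL.attained
    rw [← hy]
    exact (rationalLaunch_mem (k := k) hε hε1 fun j => ρ.τ_mem j y).1
  have hlaunch : ∀ᵐ m ∂ν, ρ.launch G m = L :=
    hνae (ρ.measurable_launch (measurableSet_singleton L))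
      (hL.ae_messageLaw (π := π) ρ.measurable_launch)
  have hall : ∀ᵐ m ∂ν, rationalLaunch k ε (fun j => ρ.τ j m) = L ∧ 0 < e i₀ m ∧
      ∀ i, 0 < ρ.τ i m → 0 ≤ α i * e i₀ m + β i := by
    filter_upwards [hlaunch, hgood, ae_all_iff.2 hagree] with m h1 h2 h3
    refine ⟨h1, pos_of_mul_pos_right (hc.trans_le h2) hL0, fun i hi => ?_⟩
    rw [← h3 i]
    exact ((ρ.vote_optimal_iff hk hkn hε hε1 i m).1 (h.vote_optimal i m)).1 hi
  have hmass : ν.real Set.univ = ∫ θ, ω.propose θ ∂F := by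
    have h1 := hνint (f := fun _ => (1 : ℝ)) measurable_const
    have h2 := hω.integral_mul_propose (G := G) (g := fun _ => 1) measurable_const (C := 1)
      (by simp)
    rw [h2] at h1
    simpa [hG, linearGame] using h1
  have hmean : ∫ m, e i₀ m ∂ν = ∫ θ, θ * ω.propose θ ∂F := by
    have h1 := hbelief i₀ (φ := fun _ => (1 : ℝ)) measurable_const (by simp)
    have h2 := hω.integral_mul_propose (G := G) (g := fun θ => (θ : ℝ)) measurable_subtype_coe
      abs_state_le
    simp only [one_mul] at h1
    rw [← h1, h2]
    rfl
  have hν0 : ν ≠ 0 := by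
    intro h0
    rw [h0] at hmass
    simp at hmass
    linarith
  have havg : ⨍ m, e i₀ m ∂ν = (∫ θ, θ * ω.propose θ ∂F) / ∫ θ, ω.propose θ ∂F := by
    rw [average_eq, hmass, hmean, smul_eq_mul, div_eq_inv_mul]
  rw [← havg]
  -- The two messages are taken outside the null set on which the almost sure properties fail.
  obtain ⟨m₁, hm₁, hle₁⟩ := exists_notMem_null_le_average hν0 (hei i₀) hall
  obtain ⟨m₂, hm₂, hle₂⟩ := exists_notMem_null_average_le hν0 (hei i₀) hall
  simp only [Set.mem_compl_iff, not_not, Set.mem_ofPred_eq] at hm₁ hm₂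
  exact rationalLaunch_le_topVotes hε hε1 hα hβ hno (fun i => ρ.τ_mem i m₁)
    (fun i => ρ.τ_mem i m₂) hm₁.2.2 hm₂.2.2 hm₁.2.1 hle₁ hle₂ hm₁.1 hm₂.1

end PublicEquilibrium

/-! ### Binary tests: posteriors, Bayes' rule and outcomes -/

noncomputable section BinaryTests

theorem bayesConsistent_of_lintegral {Y Z : Type} [MeasurableSpace Y] [MeasurableSpace Z]
    {Q : Measure (Y × Z)} [SFinite Q] {ψ : Kernel Y Z} [IsSFiniteKernel ψ]
    (h : ∀ f : Y × Z → ENNReal, Measurable f →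
      ∫⁻ q, f q ∂Q = ∫⁻ q, ∫⁻ z, f (q.1, z) ∂ψ q.1 ∂Q) : BayesConsistent Q ψ := by
  refine Measure.ext_of_lintegral _ fun f hf => ?_
  rw [h f hf, Measure.lintegral_compProd hf, Measure.fst,
    lintegral_map hf.lintegral_kernel_prod_right' measurable_fst]

/-- In state `θ` the binary test reports `b` with probability `g b θ`. -/
structure BinaryTest where
  g : Bool → State → ℝ
  measurable : ∀ b, Measurable (g b)
  nonneg : ∀ b θ, 0 ≤ g b θ
  sum_eq_one : ∀ θ, g true θ + g false θ = 1

namespace BinaryTest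

variable (T : BinaryTest)

/-- The binary test as a kernel. -/
def kernel : Kernel State Bool where
  toFun θ := ∑ b, ENNReal.ofReal (T.g b θ) • Measure.dirac b
  measurable' := by
    refine Measure.measurable_of_measurable_coe _ fun s _ => ?_
    simp only [Measure.finsetSum_apply, Measure.smul_apply, smul_eq_mul]
    exact Finset.measurable_sum _ fun b _ => (T.measurable b).ennreal_ofReal.mul_const _

theorem lintegral_kernel (θ : State) (f : Bool → ENNReal) :
    ∫⁻ s, f s ∂T.kernel θ = ∑ b, ENNReal.ofReal (T.g b θ) * f b := by
  change ∫⁻ s, f s ∂(∑ b, ENNReal.ofReal (T.g b θ) • Measure.dirac b) = _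
  simp [lintegral_smul_measure]

theorem integral_kernel (θ : State) (f : Bool → ℝ) :
    ∫ s, f s ∂T.kernel θ = ∑ b, T.g b θ * f b := by
  change ∫ s, f s ∂(∑ b, ENNReal.ofReal (T.g b θ) • Measure.dirac b) = _
  rw [integral_finsetSum_measure fun b _ => ?_]
  · simp [integral_smul_measure, ENNReal.toReal_ofReal (T.nonneg _ θ)]
  · exact (integrable_dirac (by simp)).smul_measure ENNReal.ofReal_ne_top

instance : IsMarkovKernel T.kernel := ⟨fun θ => ⟨by
  have h := T.lintegral_kernel θ fun _ => 1
  rw [lintegral_one] at h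
  rw [h]
  simp only [mul_one, Fintype.sum_bool]
  rw [← ENNReal.ofReal_add (T.nonneg _ _) (T.nonneg _ _), T.sum_eq_one, ENNReal.ofReal_one]⟩⟩

/-- The binary test as a test. -/
def toTest : Test where
  S := Bool
  π := T.kernel

theorem le_one (b : Bool) (θ : State) : T.g b θ ≤ 1 := by
  have h1 := T.sum_eq_one θ
  have h2 := T.nonneg (!b) θ
  cases b <;> simp only [Bool.not_true, Bool.not_false] at h2 <;> linarith

theorem abs_le_one (b : Bool) (θ : State) : |T.g b θ| ≤ 1 :=
  abs_le.2 ⟨by linarith [T.nonneg b θ], T.le_one b θ⟩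

variable (F : Measure State)

/-- Posteriors of a binary test; a signal of probability zero is taken to reveal the state `-1`. -/
def post (b : Bool) : Measure State :=
  if ∫ θ, T.g b θ ∂F = 0 then Measure.dirac ⟨-1, by simp⟩
  else ENNReal.ofReal (∫ θ, T.g b θ ∂F)⁻¹ • F.withDensity fun θ => ENNReal.ofReal (T.g b θ)

/-- Mean states after the signals of a binary test. -/
def mean (b : Bool) : ℝ := ∫ θ, (θ : ℝ) ∂T.post F b

theorem prob_nonneg (b : Bool) : 0 ≤ ∫ θ, T.g b θ ∂F := integral_nonneg (T.nonneg b)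

/-- Sequential rationality binds at null signals too. With posterior mean `-1`, forgoing is optimal
there whatever the launch probability. -/
theorem mean_of_null {b : Bool} (h : ∫ θ, T.g b θ ∂F = 0) : T.mean F b = -1 := by
  unfold mean post
  rw [if_pos h, integral_dirac]

variable [IsProbabilityMeasure F]

theorem integrable_g (b : Bool) : Integrable (T.g b) F :=
  integrable_of_abs_le (T.measurable b) (T.abs_le_one b)

theorem withDensity_univ (b : Bool) :
    F.withDensity (fun θ => ENNReal.ofReal (T.g b θ)) Set.univ =
      ENNReal.ofReal (∫ θ, T.g b θ ∂F) := by
  rw [withDensity_apply _ MeasurableSet.univ, Measure.restrict_univ,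
    ofReal_integral_eq_lintegral_ofReal (T.integrable_g F b) (ae_of_all _ (T.nonneg b))]

instance (b : Bool) : IsProbabilityMeasure (T.post F b) := by
  unfold post
  split_ifs with h
  · infer_instance
  · have h1 : 0 < ∫ θ, T.g b θ ∂F := lt_of_le_of_ne (T.prob_nonneg F b) (Ne.symm h)
    refine ⟨?_⟩
    rw [Measure.smul_apply, T.withDensity_univ, smul_eq_mul,
      ← ENNReal.ofReal_mul (inv_nonneg.2 h1.le), inv_mul_cancel₀ h, ENNReal.ofReal_one]

theorem withDensity_eq (b : Bool) :
    F.withDensity (fun θ => ENNReal.ofReal (T.g b θ)) =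
      ENNReal.ofReal (∫ θ, T.g b θ ∂F) • T.post F b := by
  unfold post
  split_ifs with h
  · have := T.withDensity_univ F b
    rw [h, ENNReal.ofReal_zero] at this ⊢
    rw [zero_smul]
    exact Measure.measure_univ_eq_zero.1 this
  · rw [smul_smul, ← ENNReal.ofReal_mul (T.prob_nonneg F b), mul_inv_cancel₀ h,
      ENNReal.ofReal_one, one_smul]

theorem mean_mul_prob (b : Bool) :
    T.mean F b * ∫ θ, T.g b θ ∂F = ∫ θ, θ * T.g b θ ∂F := by
  have h := congrArg (fun μ => ∫ θ : State, (θ : ℝ) ∂μ) (T.withDensity_eq F b)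
  simp only [integral_smul_measure, ENNReal.toReal_ofReal (T.prob_nonneg F b),
    smul_eq_mul] at h
  rw [integral_withDensity_eq_integral_toReal_smul (T.measurable b).ennreal_ofReal
    (by simp)] at h
  unfold mean
  rw [mul_comm, ← h]
  refine integral_congr_ae (ae_of_all _ fun θ => ?_)
  simp [ENNReal.toReal_ofReal (T.nonneg b θ), mul_comm]

theorem lintegral_signal {f : State × Bool → ENNReal} (hf : Measurable f) :
    ∫⁻ q, f q ∂(F ⊗ₘ T.kernel) =
      ∑ b, ENNReal.ofReal (∫ θ, T.g b θ ∂F) * ∫⁻ θ, f (θ, b) ∂T.post F b := by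
  have hfb : ∀ b, Measurable fun θ => f (θ, b) := fun b => hf.comp (by fun_prop)
  rw [Measure.lintegral_compProd hf]
  simp only [T.lintegral_kernel]
  rw [lintegral_finsetSum (f := fun b θ => ENNReal.ofReal (T.g b θ) * f (θ, b)) _
    fun b _ => (T.measurable b).ennreal_ofReal.mul (hfb b)]
  refine Finset.sum_congr rfl fun b _ => ?_
  rw [← smul_eq_mul (ENNReal.ofReal _), ← lintegral_smul_measure, ← T.withDensity_eq,
    lintegral_withDensity_eq_lintegral_mul _ (T.measurable b).ennreal_ofReal (hfb b)]
  rfl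

/-- The plan of a principal who conducts a binary test, proposes with probability `γ b` after the
signal `b`, and sends the messages `x b`. -/
def plan {X : Type} [MeasurableSpace X] (γ : Bool → ℝ) (hγ : ∀ b, γ b ∈ Set.Icc (0 : ℝ) 1)
    (x : Bool → X) : PrincipalPlan Bool X where
  γ := γ
  γ_measurable := measurable_of_finite γ
  γ_mem := hγ
  σ := Kernel.deterministic x (measurable_of_finite x)
  post := ⟨T.post F, measurable_of_finite _⟩
  post_markov := ⟨fun b => inferInstanceAs (IsProbabilityMeasure (T.post F b))⟩

variable {X : Type} [MeasurableSpace X] {γ : Bool → ℝ} (hγ : ∀ b, γ b ∈ Set.Icc (0 : ℝ) 1)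
  (x : Bool → X)

theorem lintegral_messageLaw {f : State × X → ENNReal} (hf : Measurable f) :
    ∫⁻ q, f q ∂messageLaw F T.kernel (T.plan F γ hγ x).γ (T.plan F γ hγ x).σ =
      ∑ b, ENNReal.ofReal (∫ θ, T.g b θ ∂F) *
        (ENNReal.ofReal (γ b) * ∫⁻ θ, f (θ, x b) ∂T.post F b) := by
  have hx : Measurable x := measurable_of_finite x
  have hσ : ∀ b, (T.plan F γ hγ x).σ b = Measure.dirac (x b) := fun b =>
    Kernel.deterministic_apply hx b
  have hγm : Measurable γ := measurable_of_finite γ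
  have hfx : Measurable fun q : State × Bool => f (q.1, x q.2) := by fun_prop
  unfold messageLaw
  rw [lintegral_map hf measurable_messageLaw_map, Measure.lintegral_compProd
    (f := fun q : (State × Bool) × X => f (q.1.1, q.2)) (by fun_prop)]
  have hin : ∀ q : State × Bool, ∫⁻ y, f (q.1, y) ∂(T.plan F γ hγ x).σ q.2 = f (q.1, x q.2) :=
    fun q => by rw [hσ, lintegral_dirac' _ (by fun_prop)]
  simp only [Kernel.prodMkLeft_apply, hin]
  unfold proposalLaw
  rw [lintegral_withDensity_eq_lintegral_mul _
    (f := fun q : State × Bool => ENNReal.ofReal ((T.plan F γ hγ x).γ q.2))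
    (hγm.comp measurable_snd).ennreal_ofReal hfx, T.lintegral_signal F]
  · refine Finset.sum_congr rfl fun b _ => ?_
    congr 1
    rw [← lintegral_const_mul _ (by fun_prop)]
    rfl
  · exact (hγm.comp measurable_snd).ennreal_ofReal.mul hfx

theorem bayes_plan :
    BayesConsistent ((F ⊗ₘ T.kernel).map Prod.swap) (T.plan F γ hγ x).post := by
  refine bayesConsistent_of_lintegral fun f hf => ?_
  have hm : Measurable fun q : Bool × State => ∫⁻ z, f (q.1, z) ∂(T.plan F γ hγ x).post q.1 :=
    hf.lintegral_kernel_prod_right'.comp measurable_fst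
  rw [lintegral_map hf measurable_swap, lintegral_map hm measurable_swap,
    T.lintegral_signal F (f := fun q => f q.swap) (hf.comp measurable_swap),
    T.lintegral_signal F (f := fun q => ∫⁻ z, f (q.swap.1, z) ∂(T.plan F γ hγ x).post q.swap.1)
      (hm.comp measurable_swap)]
  refine Finset.sum_congr rfl fun b _ => ?_
  congr 1
  simp only [Prod.swap_prod_mk, lintegral_const, measure_univ, mul_one]
  rfl

/-- When every message gives the same launch probability the choice of message is immaterial, and
only the proposal decision needs to be checked. -/
theorem principalRational_plan {n : ℕ} {G : Game n} (hG : G.F = F) (hu : ∀ θ, G.u θ = θ)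
    {ℓ : X → ℝ} {L : ℝ} (hℓ : ∀ y, ℓ y = L)
    (hopt : ∀ b, ∀ t ∈ Set.Icc (0 : ℝ) 1,
      t * (T.mean F b * L - G.c) ≤ γ b * (T.mean F b * L - G.c)) :
    PrincipalRational G T.kernel (T.plan F γ hγ x) ℓ := by
  have hpay : ∀ s y, messagePayoff G (T.plan F γ hγ x) ℓ s y = T.mean F s * L - G.c := by
    intro s y
    unfold messagePayoff
    rw [hℓ]
    simp only [hu]
    rfl
  have hpro : ∀ s, proposePayoff G (T.plan F γ hγ x) ℓ s = T.mean F s * L - G.c := by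
    intro s
    unfold proposePayoff
    simp [hpay]
  refine ⟨?_, fun s y => by rw [hpay, hpro], fun s t ht => ?_⟩
  · rw [hG]; exact T.bayes_plan F hγ x
  · rw [hpro]; exact hopt s t ht

/-- The outcome of a plan after which proposals are launched with probability `L`. -/
def outcome (hγ : ∀ b, γ b ∈ Set.Icc (0 : ℝ) 1) {L : ℝ} (hL : L ∈ Set.Icc (0 : ℝ) 1) :
    Outcome where
  propose θ := ∑ b, T.g b θ * γ b
  launch _ := L
  propose_mem θ := by
    have h1 := T.sum_eq_one θ
    rw [Fintype.sum_bool]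
    refine ⟨add_nonneg (mul_nonneg (T.nonneg _ _) (hγ _).1)
      (mul_nonneg (T.nonneg _ _) (hγ _).1), ?_⟩
    have h2 := mul_le_mul_of_nonneg_left (hγ true).2 (T.nonneg true θ)
    have h3 := mul_le_mul_of_nonneg_left (hγ false).2 (T.nonneg false θ)
    linarith
  launch_mem _ := hL

theorem induces_outcome {ℓ : X → ℝ} {L : ℝ} (hL : L ∈ Set.Icc (0 : ℝ) 1) (hℓ : ∀ y, ℓ y = L) :
    Induces T.kernel (T.plan F γ hγ x) ℓ (T.outcome hγ hL) := by
  intro θ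
  refine ⟨(T.integral_kernel θ γ).symm, ?_⟩
  simp only [hℓ, integral_const, probReal_univ, one_smul]
  rw [T.integral_kernel θ fun s => (T.plan F γ hγ x).γ s * L]
  simp only [outcome, plan, Finset.sum_mul, mul_assoc]

theorem principalPayoff_outcome {n : ℕ} {G : Game n} (hG : G.F = F) (hu : ∀ θ, G.u θ = θ)
    {L : ℝ} (hL : L ∈ Set.Icc (0 : ℝ) 1) :
    principalPayoff G (T.outcome hγ hL) =
      ∑ b, γ b * (L * (∫ θ, θ * T.g b θ ∂F) - G.c * ∫ θ, T.g b θ ∂F) := by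
  have hi : ∀ b, Integrable (fun θ : State => θ * T.g b θ) F := fun b => by
    have := T.measurable b
    refine integrable_of_abs_le (by fun_prop) (C := 1) fun θ => ?_
    rw [abs_mul]
    exact mul_le_one₀ (abs_state_le θ) (abs_nonneg _) (T.abs_le_one b θ)
  unfold principalPayoff
  have hpt : ∀ θ : State, (G.u θ * (T.outcome hγ hL).launch θ - G.c) *
      (T.outcome hγ hL).propose θ =
        ∑ b, γ b * (L * (θ * T.g b θ) - G.c * T.g b θ) := by
    intro θ
    simp only [hu, outcome, Fintype.sum_bool]
    ring
  simp only [hpt, hG]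
  rw [integral_finsetSum (f := fun b θ => γ b * (L * (θ * T.g b θ) - G.c * T.g b θ)) _
    fun b _ => (((hi b).const_mul L).sub ((T.integrable_g F b).const_mul G.c)).const_mul (γ b)]
  refine Finset.sum_congr rfl fun b _ => ?_
  rw [integral_const_mul, integral_sub ((hi b).const_mul L) ((T.integrable_g F b).const_mul G.c),
    integral_const_mul, integral_const_mul]

end BinaryTest

end BinaryTests

/-! ### Two families of equilibria: private pooling and public disclosure -/

noncomputable section Equilibria

variable {n k : ℕ} {ε c : ℝ} {α β : Fin n → ℝ} (F : Measure State) [IsProbabilityMeasure F]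
  {M : Type} [MeasurableSpace M] (T : BinaryTest)

theorem boolean_plan_mem {t : ℝ} (ht : t ∈ Set.Icc (0 : ℝ) 1) (b : Bool) :
    cond b t 0 ∈ Set.Icc (0 : ℝ) 1 := by
  cases b
  · simp
  · exact ht

/-- An assessment under private messaging with uninformative messages: the project is proposed with
probability `t` after the signal `true`, and never after `false`. -/
def pooledAssessment {t : ℝ} (ht : t ∈ Set.Icc (0 : ℝ) 1) {a : Fin n → ℝ}
    (ha : ∀ i, a i ∈ Set.Icc (0 : ℝ) 1) (m : M) : PrivateAssessment n Bool M where
  principal := T.plan F _ (boolean_plan_mem ht) fun _ _ => m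
  τ i _ := a i
  τ_measurable _ := measurable_const
  τ_mem i _ := ha i
  ψ _ := Kernel.const M ((T.post F true).map fun θ => (θ, fun _ => m))
  ψ_markov i := by
    have : IsProbabilityMeasure ((T.post F true).map
        fun θ => (θ, fun _ : {j : Fin n // j ≠ i} => m)) :=
      Measure.isProbabilityMeasure_map (by fun_prop)
    infer_instance

/-- Every message, on or off path, is met with the same votes and with the belief given the signal
`true`, so messages carry no incentives. -/
theorem isPrivateEquilibrium_pooled (hk : 1 ≤ k) (hkn : k ≤ n) (hε : 0 < ε) (hε1 : ε < 1)
    {t : ℝ} (ht : t ∈ Set.Icc (0 : ℝ) 1) {a : Fin n → ℝ} (ha : ∀ i, a i ∈ Set.Icc (0 : ℝ) 1)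
    (m : M) (hvote : ∀ i, BestVote (α i * T.mean F true + β i) (a i))
    (hopt : ∀ b, ∀ s ∈ Set.Icc (0 : ℝ) 1,
      s * (T.mean F b * rationalLaunch k ε a - c) ≤
        cond b t 0 * (T.mean F b * rationalLaunch k ε a - c)) :
    IsPrivateEquilibrium (linearGame k ε α β F c) T.kernel (pooledAssessment F T ht ha m) := by
  have : IsProbabilityMeasure (linearGame k ε α β F c).F := ‹IsProbabilityMeasure F›
  refine ⟨T.principalRational_plan F (boolean_plan_mem ht) _ rfl (fun _ => rfl)
    (fun _ => rfl) hopt, fun i => ?_, fun i m' => ?_⟩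
  · refine bayesConsistent_of_lintegral fun f hf => ?_
    set ψ := (pooledAssessment F T ht ha m).ψ i with hψ
    have hψm : ∀ y, ψ y = (T.post F true).map fun θ => (θ, fun _ => m) := fun _ => rfl
    have hm : Measurable fun q : M × (State × ({j : Fin n // j ≠ i} → M)) =>
        ∫⁻ z, f (q.1, z) ∂ψ q.1 := hf.lintegral_kernel_prod_right'.comp measurable_fst
    have hζ : Measurable fun p : State × (Fin n → M) =>
        (p.2 i, (p.1, fun j : {j : Fin n // j ≠ i} => p.2 j)) := by fun_prop
    rw [lintegral_map hf hζ, lintegral_map hm hζ]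
    change ∫⁻ q, _ ∂messageLaw F T.kernel (T.plan F _ (boolean_plan_mem ht) fun _ _ => m).γ
      (T.plan F _ (boolean_plan_mem ht) fun _ _ => m).σ =
      ∫⁻ q, _ ∂messageLaw F T.kernel (T.plan F _ (boolean_plan_mem ht) fun _ _ => m).γ
      (T.plan F _ (boolean_plan_mem ht) fun _ _ => m).σ
    rw [T.lintegral_messageLaw F _ _
        (f := fun p : State × (Fin n → M) => f (p.2 i, (p.1, fun j : {j : Fin n // j ≠ i} => p.2 j))) (hf.comp hζ),
      T.lintegral_messageLaw F _ _
        (f := fun p : State × (Fin n → M) => ∫⁻ z, f (p.2 i, z) ∂ψ (p.2 i)) (hm.comp hζ)]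
    -- There are no proposals after `false`, so only the term of `true` remains, and its posterior
    -- is the assigned belief.
    simp only [Fintype.sum_bool, cond_true, cond_false, ENNReal.ofReal_zero, zero_mul, mul_zero,
      add_zero, lintegral_const, measure_univ, mul_one]
    rw [hψm, lintegral_map (f := fun z => f (m, z)) (by fun_prop) (by fun_prop)]
  · have h := fun s => PrivateAssessment.agentPayoff_eq (k := k) (ε := ε) (c := c) (α := α)
      (β := β) (F := F) (ρ := pooledAssessment F T ht ha m) (i := i) (m := m') (a := a) s
      (ae_of_all _ fun _ _ => rfl)
    have hV : ∫ z, (α i * (z.1 : ℝ) + β i) ∂(pooledAssessment F T ht ha m).ψ i m' =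
        α i * T.mean F true + β i := by
      change ∫ z, (α i * (z.1 : ℝ) + β i) ∂(T.post F true).map
        (fun θ => (θ, fun _ : {j : Fin n // j ≠ i} => m)) = _
      rw [integral_map (by fun_prop)
        (Measurable.aestronglyMeasurable (by fun_prop)), integral_affine_state]
      rfl
    simp only [h, hV]
    exact (bestVote_iff hε1
      (pivotProb_pos hk hkn (fun j => acceptProb_mem_Ioo hε hε1 (ha j)) i) (ha i)).2 (hvote i)

variable (Msg : (S : Type) → [MeasurableSpace S] → MessageSpace S)

theorem mem_privatePayoffs (hk : 1 ≤ k) (hkn : k ≤ n) (hε : 0 < ε) (hε1 : ε < 1)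
    {t : ℝ} (ht : t ∈ Set.Icc (0 : ℝ) 1) {a : Fin n → ℝ} (ha : ∀ i, a i ∈ Set.Icc (0 : ℝ) 1)
    (hvote : ∀ i, BestVote (α i * T.mean F true + β i) (a i))
    (hopt : ∀ b, ∀ s ∈ Set.Icc (0 : ℝ) 1,
      s * (T.mean F b * rationalLaunch k ε a - c) ≤
        cond b t 0 * (T.mean F b * rationalLaunch k ε a - c)) :
    t * (rationalLaunch k ε a * (∫ θ, θ * T.g true θ ∂F) - c * ∫ θ, T.g true θ ∂F) ∈
      privatePayoffs (linearGame k ε α β F c) Msg := by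
  have hL : rationalLaunch k ε a ∈ Set.Icc (0 : ℝ) 1 := rationalLaunch_mem hε hε1 ha
  refine ⟨T.toTest, T.outcome (boolean_plan_mem ht) hL,
    ⟨pooledAssessment F T ht ha ((Msg Bool).incl ∅),
      isPrivateEquilibrium_pooled F T hk hkn hε hε1 ht ha _ hvote hopt,
      T.induces_outcome F (boolean_plan_mem ht) _ hL fun _ => rfl⟩, ?_⟩
  rw [T.principalPayoff_outcome F (boolean_plan_mem ht) (G := linearGame k ε α β F c) rfl
    (fun _ => rfl) hL]
  simp [linearGame]

open Classical in
/-- An assessment under public messaging in which the project is always proposed and the signal of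
a binary test is disclosed. -/
def disclosureAssessment {a : Bool → Fin n → ℝ} (ha : ∀ b i, a b i ∈ Set.Icc (0 : ℝ) 1)
    (x : Bool → M) (hx : MeasurableSet {x true}) : PublicAssessment n Bool M where
  principal := T.plan F (fun _ => 1) (fun _ => by simp) x
  τ i m := if m = x true then a true i else a false i
  τ_measurable i := Measurable.ite hx measurable_const measurable_const
  τ_mem i m := by
    split_ifs
    · exact ha true i
    · exact ha false i
  ψ _ := Kernel.piecewise hx (Kernel.const M (T.post F true)) (Kernel.const M (T.post F false))

/-- Every message other than `x true` is read as the signal `false`. As both coalitions yield `L`,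
all messages are equally good for the principal and truthful disclosure is optimal; `hopt` makes
proposing optimal after both signals. -/
theorem isPublicEquilibrium_disclosure (hk : 1 ≤ k) (hkn : k ≤ n) (hε : 0 < ε) (hε1 : ε < 1)
    {a : Bool → Fin n → ℝ} (ha : ∀ b i, a b i ∈ Set.Icc (0 : ℝ) 1) {x : Bool → M}
    (hx : MeasurableSet {x true}) (hne : x false ≠ x true)
    (hvote : ∀ b i, BestVote (α i * T.mean F b + β i) (a b i)) {L : ℝ}
    (hL : ∀ b, rationalLaunch k ε (a b) = L) (hopt : ∀ b, c ≤ T.mean F b * L) :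
    (∀ m, (disclosureAssessment F T ha x hx).launch (linearGame k ε α β F c) m = L) ∧
    IsPublicEquilibrium (linearGame k ε α β F c) T.kernel
      (disclosureAssessment F T ha x hx) := by
  set ρ := disclosureAssessment F T ha x hx with hρ
  have hcases : ∀ m, ∃ b, (∀ i, ρ.τ i m = a b i) ∧ ∀ i, ρ.ψ i m = T.post F b := by
    intro m
    by_cases h : m = x true
    · exact ⟨true, fun i => if_pos h, fun i => by simp [hρ, disclosureAssessment, h,
        Kernel.piecewise_apply]⟩
    · exact ⟨false, fun i => if_neg h, fun i => by simp [hρ, disclosureAssessment, h,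
        Kernel.piecewise_apply]⟩
  have hψ : ∀ i b, ρ.ψ i (x b) = T.post F b := by
    intro i b
    cases b <;> simp [hρ, disclosureAssessment, Kernel.piecewise_apply, hne]
  have hlaunch : ∀ m, ρ.launch (linearGame k ε α β F c) m = L := by
    intro m
    obtain ⟨b, hb, -⟩ := hcases m
    rw [← hL b, ← funext hb]
    rfl
  have : IsProbabilityMeasure (linearGame k ε α β F c).F := ‹IsProbabilityMeasure F›
  refine ⟨hlaunch, T.principalRational_plan F _ _ rfl (fun _ => rfl) hlaunch ?_,
    fun i => ?_, fun i m => ?_⟩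
  · intro b s hs
    exact mul_le_mul_of_nonneg_right hs.2 (sub_nonneg.2 (hopt b))
  · refine bayesConsistent_of_lintegral fun f hf => ?_
    have hm : Measurable fun q : M × State => ∫⁻ z, f (q.1, z) ∂ρ.ψ i q.1 :=
      hf.lintegral_kernel_prod_right'.comp measurable_fst
    rw [lintegral_map hf measurable_swap, lintegral_map hm measurable_swap]
    refine (T.lintegral_messageLaw F _ _ (f := fun p => f p.swap)
      (hf.comp measurable_swap)).trans (Eq.trans ?_ (T.lintegral_messageLaw F _ _
        (f := fun p => ∫⁻ z, f (p.swap.1, z) ∂ρ.ψ i p.swap.1) (hm.comp measurable_swap)).symm)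
    simp [hψ]
  · rw [PublicAssessment.vote_optimal_iff hk hkn hε hε1]
    obtain ⟨b, hb, hb'⟩ := hcases m
    rw [hb, hb']
    exact hvote b i

theorem mem_publicPayoffs (hk : 1 ≤ k) (hkn : k ≤ n) (hε : 0 < ε) (hε1 : ε < 1)
    {a : Bool → Fin n → ℝ} (ha : ∀ b i, a b i ∈ Set.Icc (0 : ℝ) 1)
    (hvote : ∀ b i, BestVote (α i * T.mean F b + β i) (a b i)) {L : ℝ}
    (hL : ∀ b, rationalLaunch k ε (a b) = L) (hopt : ∀ b, c ≤ T.mean F b * L) :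
    L * (∫ θ, (θ : ℝ) ∂F) - c ∈ publicPayoffs (linearGame k ε α β F c) Msg := by
  have hL1 : L ∈ Set.Icc (0 : ℝ) 1 := hL true ▸ rationalLaunch_mem hε hε1 (ha true)
  -- That reports embed measurably is what makes the agents' reading of messages measurable.
  have hx : MeasurableSet {(Msg Bool).incl {true}} := by
    have := (Msg Bool).report.measurableSet_image.2 (measurableSet_singleton true)
    rwa [Set.image_singleton] at this
  have hne : (Msg Bool).incl {false} ≠ (Msg Bool).incl {true} := fun h => by
    have := (Msg Bool).report.injective h
    simp at this
  obtain ⟨hlaunch, heq⟩ := isPublicEquilibrium_disclosure F T (α := α) (β := β) hk hkn hε hε1 ha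
    (x := fun b => (Msg Bool).incl {b}) hx hne hvote hL hopt
  refine ⟨T.toTest, T.outcome (γ := fun _ => 1) (fun _ => by simp) hL1,
    ⟨_, heq, T.induces_outcome F _ _ hL1 hlaunch⟩, ?_⟩
  rw [T.principalPayoff_outcome F _ (G := linearGame k ε α β F c) rfl (fun _ => rfl) hL1]
  have hi : ∀ b, Integrable (fun θ : State => θ * T.g b θ) F := fun b => by
    have := T.measurable b
    refine integrable_of_abs_le (by fun_prop) (C := 1) fun θ => ?_
    rw [abs_mul]
    exact mul_le_one₀ (abs_state_le θ) (abs_nonneg _) (T.abs_le_one b θ)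
  have h1 : ∫ θ, T.g true θ ∂F + ∫ θ, T.g false θ ∂F = 1 := by
    rw [← integral_add (T.integrable_g F true) (T.integrable_g F false)]
    simp [T.sum_eq_one]
  have h2 : (∫ θ, θ * T.g true θ ∂F) + ∫ θ, θ * T.g false θ ∂F = ∫ θ, (θ : ℝ) ∂F := by
    rw [← integral_add (hi true) (hi false)]
    simp [← mul_add, T.sum_eq_one]
  simp only [Fintype.sum_bool, linearGame, one_mul]
  rw [← h2]
  linear_combination c * h1

end Equilibria

/-! ### Without conflicting allies, private pooling does as well as public messaging -/

noncomputable section Pooling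

variable {n k : ℕ} {ε c : ℝ} {α β : Fin n → ℝ}

open Classical in
/-- The votes of agents who believe that the mean state is `μ` and reject when indifferent. -/
def bottomVotes (α β : Fin n → ℝ) (μ : ℝ) (i : Fin n) : ℝ :=
  if 0 < α i * μ + β i then 1 else 0

theorem bottomVotes_mem (α β : Fin n → ℝ) (μ : ℝ) (i : Fin n) :
    bottomVotes α β μ i ∈ Set.Icc (0 : ℝ) 1 := by
  unfold bottomVotes; split_ifs <;> simp

theorem bottomVotes_le_topVotes (α β : Fin n → ℝ) (μ : ℝ) (i : Fin n) :
    bottomVotes α β μ i ≤ topVotes α β μ i :=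
  le_topVotes (bottomVotes_mem α β μ) fun h => by
    unfold bottomVotes at h
    split_ifs at h with h1
    · exact h1.le
    · exact absurd h (lt_irrefl _)

theorem bestVote_of_between {μ t : ℝ} {i : Fin n} (h1 : bottomVotes α β μ i ≤ t)
    (h2 : t ≤ topVotes α β μ i) : BestVote (α i * μ + β i) t := by
  refine ⟨fun h => ?_, fun h => ?_⟩
  · unfold topVotes at h2
    split_ifs at h2 with h3
    · exact h3
    · linarith
  · unfold bottomVotes at h1
    split_ifs at h1 with h3
    · linarith
    · exact not_lt.1 h3

theorem bestVote_topVotes (μ : ℝ) (i : Fin n) :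
    BestVote (α i * μ + β i) (topVotes α β μ i) :=
  bestVote_of_between (bottomVotes_le_topVotes α β μ i) le_rfl

/-- Indifferent agents can be made to mix so that any intermediate launch probability results. -/
theorem exists_bestVotes {μ L : ℝ} (h1 : rationalLaunch k ε (bottomVotes α β μ) ≤ L)
    (h2 : L ≤ rationalLaunch k ε (topVotes α β μ)) :
    ∃ a : Fin n → ℝ, (∀ i, a i ∈ Set.Icc (0 : ℝ) 1) ∧
      (∀ i, BestVote (α i * μ + β i) (a i)) ∧ rationalLaunch k ε a = L := by
  -- On the segment between the two extreme vote profiles only indifferent agents vary, so the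
  -- intermediate value theorem stays within optimal votes.
  set f : ℝ → Fin n → ℝ := fun s i =>
    bottomVotes α β μ i + s * (topVotes α β μ i - bottomVotes α β μ i) with hf
  have hcont : Continuous fun s => rationalLaunch k ε (f s) :=
    continuous_rationalLaunch.comp (by fun_prop)
  have h0 : f 0 = bottomVotes α β μ := by ext; simp [hf]
  have h1' : f 1 = topVotes α β μ := by ext; simp [hf]
  obtain ⟨s, hs, hsL⟩ := intermediate_value_Icc zero_le_one hcont.continuousOn
    (show L ∈ Set.Icc _ _ from ⟨by rw [h0]; exact h1, by rw [h1']; exact h2⟩)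
  have hd := fun i => sub_nonneg.2 (bottomVotes_le_topVotes α β μ i)
  have hlo : ∀ i, bottomVotes α β μ i ≤ f s i := fun i =>
    le_add_of_nonneg_right (mul_nonneg hs.1 (hd i))
  have hhi : ∀ i, f s i ≤ topVotes α β μ i := fun i => by
    have := mul_le_mul_of_nonneg_right hs.2 (hd i)
    simp only [hf]
    linarith
  exact ⟨f s, fun i => ⟨(bottomVotes_mem α β μ i).1.trans (hlo i),
    (hhi i).trans (topVotes_mem α β μ i).2⟩, fun i => bestVote_of_between (hlo i) (hhi i), hsL⟩

/-- Accepting under indifference makes the launch probability upper semicontinuous in the mean: the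
set is a finite union, over coalitions that suffice for `L`, of the closed sets where all their
members accept. -/
theorem isClosed_le_topVotes (hε : 0 < ε) (hε1 : ε < 1) (L : ℝ) :
    IsClosed {μ : ℝ | L ≤ rationalLaunch k ε (topVotes α β μ)} := by
  classical
  have : {μ : ℝ | L ≤ rationalLaunch k ε (topVotes α β μ)} =
      ⋃ A : {A : Finset (Fin n) // L ≤ rationalLaunch k ε fun i => if i ∈ A then 1 else 0},
        ⋂ i ∈ A.1, {μ : ℝ | 0 ≤ α i * μ + β i} := by
    ext μ
    simp only [Set.mem_ofPred_eq, Set.mem_iUnion, Set.mem_iInter]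
    constructor
    · intro h
      refine ⟨⟨Finset.univ.filter fun i => 0 ≤ α i * μ + β i, h.trans (le_of_eq ?_)⟩,
        fun i hi => (Finset.mem_filter.1 hi).2⟩
      congr 1
      ext i
      simp [topVotes]
    · rintro ⟨⟨A, hA⟩, h⟩
      have hA1 : ∀ i, (if i ∈ A then (1 : ℝ) else 0) ∈ Set.Icc (0 : ℝ) 1 := fun i => by
        split_ifs <;> simp
      refine hA.trans (rationalLaunch_mono hε hε1 hA1 (topVotes_mem α β μ) fun i =>
        le_topVotes hA1 fun hi => h i ?_)
      by_contra hiA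
      simp [hiA] at hi
  rw [this]
  exact isClosed_iUnion_of_finite fun A => isClosed_biInter fun i _ =>
    isClosed_le continuous_const (by fun_prop)

/-- Dually, rejecting under indifference makes the launch probability lower semicontinuous; the
union runs over coalitions `A` with launch probability at most `L`, and everyone outside `A` must be
willing to reject. -/
theorem isClosed_bottomVotes_le (hε : 0 < ε) (hε1 : ε < 1) (L : ℝ) :
    IsClosed {μ : ℝ | rationalLaunch k ε (bottomVotes α β μ) ≤ L} := by
  classical
  have : {μ : ℝ | rationalLaunch k ε (bottomVotes α β μ) ≤ L} =
      ⋃ A : {A : Finset (Fin n) // rationalLaunch k ε (fun i => if i ∈ A then 1 else 0) ≤ L},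
        ⋂ i ∈ A.1ᶜ, {μ : ℝ | α i * μ + β i ≤ 0} := by
    ext μ
    simp only [Set.mem_ofPred_eq, Set.mem_iUnion, Set.mem_iInter]
    constructor
    · intro h
      refine ⟨⟨Finset.univ.filter fun i => 0 < α i * μ + β i, le_trans (le_of_eq ?_) h⟩,
        fun i hi => ?_⟩
      · congr 1
        ext i
        simp [bottomVotes]
      · simpa using hi
    · rintro ⟨⟨A, hA⟩, h⟩
      have hA1 : ∀ i, (if i ∈ A then (1 : ℝ) else 0) ∈ Set.Icc (0 : ℝ) 1 := fun i => by
        split_ifs <;> simp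
      refine (rationalLaunch_mono hε hε1 (bottomVotes_mem α β μ) hA1 fun i => ?_).trans hA
      by_cases hiA : i ∈ A
      · simpa [hiA] using (bottomVotes_mem α β μ i).2
      · have := h i (by simpa using hiA)
        simp [hiA, bottomVotes, not_lt.2 this]
  rw [this]
  exact isClosed_iUnion_of_finite fun A => isClosed_biInter fun i _ =>
    isClosed_le (by fun_prop) continuous_const

/-- The binary test that reports `true` with probability `h θ`. -/
def binaryTestOf (h : State → ℝ) (hm : Measurable h) (h1 : ∀ θ, h θ ∈ Set.Icc (0 : ℝ) 1) :
    BinaryTest where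
  g b θ := cond b (h θ) (1 - h θ)
  measurable b := by
    cases b
    · exact measurable_const.sub hm
    · exact hm
  nonneg b θ := by
    cases b
    · exact sub_nonneg.2 (h1 θ).2
    · exact (h1 θ).1
  sum_eq_one θ := by simp

variable (F : Measure State) [IsProbabilityMeasure F]
  (Msg : (S : Type) → [MeasurableSpace S] → MessageSpace S)

/-- The signal `true` recommends proposing. The principal's incentives reduce to two inequalities
between integrals: proposing pays on the recommended mass and does not pay on the rest. -/
theorem mem_privatePayoffs_of_pooling (hk : 1 ≤ k) (hkn : k ≤ n) (hε : 0 < ε) (hε1 : ε < 1)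
    (hc : 0 < c) {h : State → ℝ} (hm : Measurable h) (h1 : ∀ θ, h θ ∈ Set.Icc (0 : ℝ) 1)
    {N D N₀ D₀ : ℝ} (hN : ∫ θ, θ * h θ ∂F = N) (hD : ∫ θ, h θ ∂F = D)
    (hN₀ : ∫ θ, θ * (1 - h θ) ∂F = N₀) (hD₀ : ∫ θ, (1 - h θ) ∂F = D₀) (hpos : 0 < D)
    {a : Fin n → ℝ} (ha : ∀ i, a i ∈ Set.Icc (0 : ℝ) 1)
    (hvote : ∀ i, BestVote (α i * (N / D) + β i) (a i))
    (hprop : c * D ≤ rationalLaunch k ε a * N)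
    (hforgo : rationalLaunch k ε a * N₀ ≤ c * D₀) :
    rationalLaunch k ε a * N - c * D ∈ privatePayoffs (linearGame k ε α β F c) Msg := by
  set T := binaryTestOf h hm h1 with hT
  have hL := rationalLaunch_mem (k := k) hε hε1 ha
  have e1 : T.mean F true * D = N := by
    have := T.mean_mul_prob F true
    simpa only [hT, binaryTestOf, cond_true, hD, hN] using this
  have e2 : T.mean F false * D₀ = N₀ := by
    have := T.mean_mul_prob F false
    simpa only [hT, binaryTestOf, cond_false, hD₀, hN₀] using this
  have e3 : T.mean F true = N / D := by rw [← e1, mul_div_cancel_right₀ _ hpos.ne']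
  have p1 : c ≤ T.mean F true * rationalLaunch k ε a := by
    refine le_of_mul_le_mul_right ?_ hpos
    rw [← e1] at hprop
    linarith
  have p2 : T.mean F false * rationalLaunch k ε a ≤ c := by
    have hD₀' : 0 ≤ D₀ := by rw [← hD₀]; exact T.prob_nonneg F false
    rcases hD₀'.eq_or_lt with h0 | h0
    · rw [T.mean_of_null F (b := false) (by rw [h0]; exact hD₀)]
      linarith [hL.1]
    · refine le_of_mul_le_mul_right ?_ h0
      rw [← e2] at hforgo
      linarith
  have := mem_privatePayoffs F T Msg (c := c) (α := α) (β := β) hk hkn hε hε1 (t := 1) (by simp)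
    ha (by rw [e3]; exact hvote) fun b s hs => by
      cases b
      · rw [cond_false, zero_mul]
        exact mul_nonpos_of_nonneg_of_nonpos hs.1 (by linarith)
      · rw [cond_true]
        exact mul_le_mul_of_nonneg_right hs.2 (by linarith)
  simpa only [hT, binaryTestOf, cond_true, hN, hD, one_mul] using this

/-- Under an uninformative test the principal proposes exactly when this is profitable. Besides
settling nonpositive public payoffs, it shows that private payoffs are nonempty. -/
theorem exists_nonneg_mem_privatePayoffs (hk : 1 ≤ k) (hkn : k ≤ n) (hε : 0 < ε) (hε1 : ε < 1)
    (hc : 0 < c) : ∃ w ∈ privatePayoffs (linearGame k ε α β F c) Msg, 0 ≤ w := by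
  set T := binaryTestOf (fun _ => 1) measurable_const (fun _ => by simp) with hT
  have e1 : T.mean F true = ∫ θ, (θ : ℝ) ∂F := by
    have := T.mean_mul_prob F true
    simpa [hT, binaryTestOf] using this
  have e2 : T.mean F false = -1 := T.mean_of_null F (by simp [hT, binaryTestOf])
  set L := rationalLaunch k ε (topVotes α β (∫ θ, (θ : ℝ) ∂F)) with hLdef
  have hL := rationalLaunch_mem (k := k) hε hε1 (topVotes_mem α β (∫ θ, (θ : ℝ) ∂F))
  have hvote : ∀ i, BestVote (α i * T.mean F true + β i)
      (topVotes α β (∫ θ, (θ : ℝ) ∂F) i) := by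
    rw [e1]; exact bestVote_topVotes _
  by_cases h : c ≤ (∫ θ, (θ : ℝ) ∂F) * L
  · refine ⟨_, mem_privatePayoffs F T Msg hk hkn hε hε1 (t := 1) (by simp)
      (topVotes_mem α β _) hvote fun b s hs => ?_, ?_⟩
    · cases b
      · rw [cond_false, zero_mul, e2]
        exact mul_nonpos_of_nonneg_of_nonpos hs.1 (by linarith [hL.1])
      · rw [cond_true, e1]
        exact mul_le_mul_of_nonneg_right hs.2 (by linarith)
    · simp only [hT, binaryTestOf, cond_true, mul_one, integral_const, probReal_univ, one_smul,
        one_mul]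
      linarith
  · refine ⟨_, mem_privatePayoffs F T Msg hk hkn hε hε1 (t := 0) (by simp)
      (topVotes_mem α β _) hvote fun b s hs => ?_, by simp⟩
    cases b
    · rw [cond_false, zero_mul, e2]
      exact mul_nonpos_of_nonneg_of_nonpos hs.1 (by linarith [hL.1])
    · rw [cond_true, zero_mul, e1]
      exact mul_nonpos_of_nonneg_of_nonpos hs.1 (by linarith)

/-- Without conflicting allies, whatever the principal can get under public messaging she can also
get under private messaging. -/
theorem exists_privatePayoff_ge (hn : 0 < n) (hk : 1 ≤ k) (hkn : k ≤ n) (hε : 0 < ε)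
    (hε1 : ε < 1) (hc : 0 < c) (hα : ∀ i, α i = -1 ∨ α i = 1)
    (hβ : ∀ i, β i ∈ Set.Ioo (-1 : ℝ) 1) (hno : ¬∃ i j : Fin n, ConflictingAllies α β i j)
    {w : ℝ} (hw : w ∈ publicPayoffs (linearGame k ε α β F c) Msg) :
    ∃ v ∈ privatePayoffs (linearGame k ε α β F c) Msg, w ≤ v := by
  have : IsProbabilityMeasure (linearGame k ε α β F c).F := ‹IsProbabilityMeasure F›
  obtain ⟨v₀, hv₀, hv₀0⟩ :=
    exists_nonneg_mem_privatePayoffs (α := α) (β := β) F Msg hk hkn hε hε1 hc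
  rcases le_or_gt w 0 with hw0 | hw0
  · exact ⟨v₀, hv₀, hw0.trans hv₀0⟩
  obtain ⟨t, ω, ⟨ρ, hρ, hω⟩, rfl⟩ := hw
  rcases hρ.launchesAt hε hε1 hc hω with h0 | ⟨L, hL⟩
  · simp [principalPayoff, h0] at hw0
  have hpay := hL.principalPayoff_eq hω fun _ => rfl
  have hfor := hL.forgo_le hω hρ.principal.bayes
  have hgm := hω.measurable_propose
  have hLtop := hρ.le_topVotes hn hk hkn hε hε1 hc hα hβ hno hω hL
  have hL0 : 0 ≤ L := by
    obtain ⟨y, hy⟩ := hL.attained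
    rw [← hy]
    exact (rationalLaunch_mem (k := k) hε hε1 fun j => ρ.τ_mem j y).1
  change _ = L * (∫ θ, θ * ω.propose θ ∂F) - c * ∫ θ, ω.propose θ ∂F at hpay
  change L * (∫ θ, θ * (1 - ω.propose θ) ∂F) ≤ c * ∫ θ, (1 - ω.propose θ) ∂F at hfor
  set g := ω.propose with hg
  have hg1 : ∀ θ, g θ ∈ Set.Icc (0 : ℝ) 1 := ω.propose_mem
  have hga : ∀ θ, |g θ| ≤ 1 := abs_propose_le ω
  have hg0a : ∀ θ, |1 - g θ| ≤ 1 := fun θ =>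
    abs_le.2 ⟨by linarith [(hg1 θ).2], by linarith [(hg1 θ).1]⟩
  have hi1 : Integrable g F := integrable_of_abs_le hgm hga
  have hi2 : Integrable (fun θ : State => θ * g θ) F :=
    integrable_of_abs_le (by fun_prop) (C := 1) fun θ => by
      rw [abs_mul]
      exact mul_le_one₀ (abs_state_le θ) (abs_nonneg _) (hga θ)
  have hi3 : Integrable (fun θ => 1 - g θ) F := (integrable_const 1).sub hi1
  have hi4 : Integrable (fun θ : State => θ * (1 - g θ)) F :=
    integrable_of_abs_le (by fun_prop) (C := 1) fun θ => by
      rw [abs_mul]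
      exact mul_le_one₀ (abs_state_le θ) (abs_nonneg _) (hg0a θ)
  set N := ∫ θ, θ * g θ ∂F with hN
  set D := ∫ θ, g θ ∂F with hD
  set N₀ := ∫ θ, θ * (1 - g θ) ∂F with hN₀
  set D₀ := ∫ θ, (1 - g θ) ∂F with hD₀
  rw [hpay] at hw0 ⊢
  have hD0 : 0 ≤ D := integral_nonneg fun θ => (hg1 θ).1
  have hD₀0 : 0 ≤ D₀ := integral_nonneg fun θ => sub_nonneg.2 (hg1 θ).2
  have hND : N ≤ D := integral_mono hi2 hi1 fun θ =>
    mul_le_of_le_one_left (hg1 θ).1 θ.2.2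
  have hNpos : 0 < N := pos_of_mul_pos_right (by nlinarith : 0 < L * N) hL0
  have hDpos : 0 < D := hNpos.trans_le hND
  replace hLtop := hLtop hDpos
  -- The recommended proposal probability is raised from `g` to `g + s * (1 - g)`: a share `s` of
  -- the forgone mass is pooled into the proposal.
  have key : ∀ s ∈ Set.Icc (0 : ℝ) 1, ∀ a : Fin n → ℝ, (∀ i, a i ∈ Set.Icc (0 : ℝ) 1) →
      (∀ i, BestVote (α i * ((N + s * N₀) / (D + s * D₀)) + β i) (a i)) →
      c * (D + s * D₀) ≤ rationalLaunch k ε a * (N + s * N₀) →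
      rationalLaunch k ε a * ((1 - s) * N₀) ≤ c * ((1 - s) * D₀) →
      rationalLaunch k ε a * (N + s * N₀) - c * (D + s * D₀) ∈
        privatePayoffs (linearGame k ε α β F c) Msg := by
    intro s hs a ha hvote h1 h2
    refine mem_privatePayoffs_of_pooling F Msg hk hkn hε hε1 hc
      (h := fun θ => g θ + s * (1 - g θ)) (by fun_prop) (fun θ => ?_) ?_ ?_
      (N₀ := (1 - s) * N₀) (D₀ := (1 - s) * D₀) ?_ ?_ ?_ ha hvote h1 h2
    · have h3 := hg1 θ
      exact ⟨add_nonneg h3.1 (mul_nonneg hs.1 (sub_nonneg.2 h3.2)), by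
        have := mul_le_mul_of_nonneg_right hs.2 (sub_nonneg.2 h3.2)
        linarith⟩
    · rw [hN, hN₀, ← integral_const_mul, ← integral_add hi2 (hi4.const_mul s)]
      exact integral_congr_ae (ae_of_all _ fun θ => by simp only; ring)
    · rw [hD, hD₀, ← integral_const_mul, ← integral_add hi1 (hi3.const_mul s)]
    · rw [hN₀, ← integral_const_mul]
      exact integral_congr_ae (ae_of_all _ fun θ => by simp only; ring)
    · rw [hD₀, ← integral_const_mul]
      exact integral_congr_ae (ae_of_all _ fun θ => by simp only; ring)
    · have := mul_nonneg hs.1 hD₀0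
      linarith
  set top : ℝ → ℝ := fun μ => rationalLaunch k ε (topVotes α β μ) with htop
  -- If the higher launch probability at `N / D` still leaves forgoing optimal on the rest, no mass
  -- has to be moved.
  by_cases hcase : top (N / D) * N₀ ≤ c * D₀
  · have h1 : L * N ≤ top (N / D) * N := mul_le_mul_of_nonneg_right hLtop hNpos.le
    have := key 0 (by simp) (topVotes α β (N / D)) (topVotes_mem α β _)
      (by simpa using bestVote_topVotes (α := α) (β := β) (N / D))
      (by simp only [zero_mul, add_zero]; change _ ≤ top (N / D) * N; linarith)
      (by simpa using hcase)
    refine ⟨_, this, ?_⟩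
    simp only [zero_mul, add_zero]
    change _ ≤ top (N / D) * N - c * D
    linarith
  push Not at hcase
  have htop0 : ∀ μ, 0 ≤ top μ := fun μ => (rationalLaunch_mem hε hε1 (topVotes_mem α β μ)).1
  have hN₀pos : 0 < N₀ :=
    pos_of_mul_pos_right ((mul_nonneg hc.le hD₀0).trans_lt hcase) (htop0 _)
  -- At launch probability `ℓ` the principal is indifferent about the forgone mass, so moving any
  -- share of it leaves her payoff at `ℓ * N - c * D`, and `L ≤ ℓ` by the old forgo constraint.
  set ℓ := c * D₀ / N₀ with hℓ
  have hℓN : ℓ * N₀ = c * D₀ := div_mul_cancel₀ _ hN₀pos.ne'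
  have hLℓ : L ≤ ℓ := (le_div_iff₀ hN₀pos).2 hfor
  have hℓtop : ℓ ≤ top (N / D) := ((div_lt_iff₀ hN₀pos).2 hcase).le
  have hℓw : L * N ≤ ℓ * N := mul_le_mul_of_nonneg_right hLℓ hNpos.le
  let m : unitInterval → ℝ := fun s => (N + s * N₀) / (D + s * D₀)
  have hmc : Continuous m := by
    refine Continuous.div (by fun_prop) (by fun_prop) fun s => ?_
    have := mul_nonneg s.2.1 hD₀0
    exact (by linarith : (0 : ℝ) < D + s * D₀).ne'
  by_cases hbot : ∃ s : unitInterval, rationalLaunch k ε (bottomVotes α β (m s)) ≤ ℓ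
  -- Two closed sets of shares cover the interval because `bottomVotes` never exceeds `topVotes`,
  -- and each is nonempty. By connectedness they meet, and at a common share the indifferent agents
  -- can mix so as to produce exactly `ℓ`.
  · have hconn := isPreconnected_closed_iff.1 (isPreconnected_univ (α := unitInterval))
      (m ⁻¹' {μ | ℓ ≤ top μ}) (m ⁻¹' {μ | rationalLaunch k ε (bottomVotes α β μ) ≤ ℓ})
      ((isClosed_le_topVotes hε hε1 ℓ).preimage hmc)
      ((isClosed_bottomVotes_le hε hε1 ℓ).preimage hmc)
      (fun s _ => by
        rcases le_total ℓ (top (m s)) with h | h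
        · exact Or.inl h
        · exact Or.inr ((rationalLaunch_mono hε hε1 (bottomVotes_mem α β _)
            (topVotes_mem α β _) (bottomVotes_le_topVotes α β _)).trans h))
      ⟨0, trivial, by simpa [m] using hℓtop⟩
      (by obtain ⟨s, hs⟩ := hbot; exact ⟨s, trivial, hs⟩)
    obtain ⟨s, -, hs1, hs2⟩ := hconn
    obtain ⟨a, ha, hvote, haℓ⟩ := exists_bestVotes (α := α) (β := β) hs2 hs1
    have hval : ℓ * (N + s * N₀) - c * (D + s * D₀) = ℓ * N - c * D := by
      linear_combination (s : ℝ) * hℓN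
    have := key s s.2 a ha hvote (by rw [haℓ]; linarith)
      (by rw [haℓ]; exact le_of_eq (by linear_combination (1 - (s : ℝ)) * hℓN))
    refine ⟨_, this, ?_⟩
    rw [haℓ, hval]
    linarith
  -- Otherwise the launch probability exceeds `ℓ` at every share. Then everything is pooled, `s =
  -- 1`, and no forgo constraint is left.
  · push Not at hbot
    have h1 : ℓ ≤ top (m 1) := (hbot 1).le.trans (rationalLaunch_mono hε hε1
      (bottomVotes_mem α β _) (topVotes_mem α β _) (bottomVotes_le_topVotes α β _))
    have hm1 : m 1 = (N + 1 * N₀) / (D + 1 * D₀) := by simp [m]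
    have h2 : ℓ * (N + 1 * N₀) ≤ top (m 1) * (N + 1 * N₀) :=
      mul_le_mul_of_nonneg_right h1 (by linarith)
    have := key 1 (by simp) (topVotes α β (m 1)) (topVotes_mem α β _)
      (by rw [← hm1]; exact bestVote_topVotes _)
      (by change _ ≤ top (m 1) * _; linarith) (by simp)
    refine ⟨_, this, ?_⟩
    change _ ≤ top (m 1) * _ - _
    linarith

end Pooling

/-! ### With conflicting allies, a prior and a cost that favour public messaging -/

noncomputable section Conflict

variable {n k : ℕ} {ε c : ℝ} {α β : Fin n → ℝ}

/-- Conflicting allies with the smallest gap between their thresholds have no other threshold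
between theirs. -/
theorem exists_adjacent_conflictingAllies (hα : ∀ i, α i = -1 ∨ α i = 1)
    (h : ∃ i j : Fin n, ConflictingAllies α β i j) :
    ∃ i j : Fin n, ConflictingAllies α β i j ∧
      ∀ l, threshold α β l ≤ threshold α β i ∨ threshold α β j ≤ threshold α β l := by
  classical
  obtain ⟨i₀, j₀, h₀⟩ := h
  obtain ⟨⟨i, j⟩, hij, hmin⟩ := Finset.exists_min_image
    (Finset.univ.filter fun p : Fin n × Fin n => ConflictingAllies α β p.1 p.2)
    (fun p => threshold α β p.2 - threshold α β p.1) ⟨(i₀, j₀), by simpa using h₀⟩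
  simp only [Finset.mem_filter, Finset.mem_univ, true_and] at hij hmin
  obtain ⟨-, h2, h3, h4, h5, h6⟩ := id hij
  refine ⟨i, j, hij, fun l => ?_⟩
  by_contra hl
  push Not at hl
  -- An agent with a threshold strictly between would form a closer pair of conflicting allies, with
  -- `j` if his slope is `-1` and with `i` if it is `1`.
  rcases hα l with hl' | hl'
  · have := hmin (l, j) ⟨fun e : l = j => by rw [e] at hl; exact lt_irrefl _ hl.2, hl', h3,
      h4.trans hl.1, hl.2, h6⟩
    simp only at this
    linarith
  · have := hmin (i, l) ⟨fun e : i = l => by rw [← e] at hl; exact lt_irrefl _ hl.1, h2, hl', h4,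
      hl.1, hl.2.trans h6⟩
    simp only at this
    linarith

/-- Distinct thresholds leave room around the adjacent pair, so that on the widened interval only
the votes of `i` and `j` depend on the mean state. Each requirement holds for all small `η > 0`. -/
theorem exists_isolating_interval {ι : Type*} [Finite ι] {δ : ι → ℝ}
    (hδ : Function.Injective δ) {i j : ι} (h0 : 0 < δ i) (hij : δ i < δ j) (h1 : δ j < 1)
    (hadj : ∀ l, δ l ≤ δ i ∨ δ j ≤ δ l) :
    ∃ η, 0 < η ∧ 0 < δ i - η ∧ δ j + η < 1 ∧ η < δ j - δ i ∧
      ∀ l, l ≠ i → l ≠ j → δ l < δ i - η ∨ δ j + η < δ l := by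
  have hlt : ∀ {κ : ℝ}, 0 < κ → ∀ᶠ η in nhdsWithin (0 : ℝ) (Set.Ioi 0), η < κ := fun hκ =>
    (eventually_lt_nhds hκ).filter_mono nhdsWithin_le_nhds
  have hall : ∀ l, ∀ᶠ η in nhdsWithin (0 : ℝ) (Set.Ioi 0),
      l ≠ i → l ≠ j → δ l < δ i - η ∨ δ j + η < δ l := by
    intro l
    by_cases hi : l = i
    · exact Filter.Eventually.of_forall fun _ h => absurd hi h
    by_cases hj : l = j
    · exact Filter.Eventually.of_forall fun _ _ h => absurd hj h
    rcases hadj l with h | h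
    · filter_upwards [hlt (sub_pos.2 (lt_of_le_of_ne h fun e => hi (hδ e)))] with η hη _ _
      exact Or.inl (by linarith)
    · filter_upwards [hlt (sub_pos.2 (lt_of_le_of_ne h fun e => hj (hδ e.symm)))] with η hη _ _
      exact Or.inr (by linarith)
  have hmem : ∀ᶠ η in nhdsWithin (0 : ℝ) (Set.Ioi 0), 0 < η := self_mem_nhdsWithin
  obtain ⟨η, hη0, hη1, hη2, hη3, hη4⟩ := (hmem.and ((hlt h0).and
    ((hlt (sub_pos.2 h1)).and ((hlt (sub_pos.2 hij)).and (Filter.eventually_all.2 hall))))).exists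
  exact ⟨η, hη0, by linarith, by linarith, hη3, hη4⟩

/-- There are atomless distributions on any nondegenerate interval of states. -/
theorem exists_atomless_on_Icc {a b : ℝ} (ha : -1 ≤ a) (hab : a < b) (hb : b ≤ 1) :
    ∃ μ : Measure State, IsProbabilityMeasure μ ∧ (∀ θ, μ {θ} = 0) ∧
      ∀ᵐ θ : State ∂μ, (θ : ℝ) ∈ Set.Icc a b := by
  have hmem : ∀ s : unitInterval, a + s * (b - a) ∈ Set.Icc a b := fun s =>
    ⟨le_add_of_nonneg_right (mul_nonneg s.2.1 (sub_pos.2 hab).le), by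
      have := mul_le_mul_of_nonneg_right s.2.2 (sub_pos.2 hab).le
      linarith⟩
  let f : unitInterval → State := fun s =>
    ⟨a + s * (b - a), ha.trans (hmem s).1, (hmem s).2.trans hb⟩
  have hf : Measurable f := Measurable.subtype_mk (by fun_prop)
  have hinj : Function.Injective f := fun s t hst => by
    have h1 : a + (s : ℝ) * (b - a) = a + (t : ℝ) * (b - a) := congrArg Subtype.val hst
    have h2 : (s : ℝ) * (b - a) = t * (b - a) := by linarith
    exact Subtype.ext (mul_right_cancel₀ (sub_pos.2 hab).ne' h2)
  refine ⟨volume.map f, Measure.isProbabilityMeasure_map hf.aemeasurable, fun θ => ?_, ?_⟩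
  · rw [Measure.map_apply hf (measurableSet_singleton θ)]
    exact (Set.subsingleton_singleton.preimage hinj).measure_zero _
  · rw [ae_map_iff hf.aemeasurable (measurable_subtype_coe measurableSet_Icc)]
    exact ae_of_all _ hmem

/-- The even mixture of an atomless law below `x` and one above `y`: no mass lies in the gap, but
the overall mean will. -/
theorem exists_two_cluster_prior {lo x y hi : ℝ} (h0 : -1 ≤ lo) (h1 : lo < x) (h2 : x < y)
    (h3 : y < hi) (h4 : hi ≤ 1) :
    ∃ F : Measure State, IsProbabilityMeasure F ∧ (∀ θ, F {θ} = 0) ∧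
      (∀ᵐ θ : State ∂F, (θ : ℝ) ∈ Set.Icc lo x ∪ Set.Icc y hi) ∧
      F.real {θ | y ≤ (θ : ℝ)} = 1 / 2 := by
  obtain ⟨μ, hμ, hμ0, hμs⟩ := exists_atomless_on_Icc h0 h1 (by linarith)
  obtain ⟨ν, hν, hν0, hνs⟩ := exists_atomless_on_Icc (a := y) (b := hi) (by linarith) h3 h4
  refine ⟨(2⁻¹ : ENNReal) • μ + (2⁻¹ : ENNReal) • ν, ⟨?_⟩, fun θ => ?_, ?_, ?_⟩
  · simp [ENNReal.inv_two_add_inv_two]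
  · simp [hμ0, hν0]
  · rw [ae_add_measure_iff]
    exact ⟨Measure.ae_smul_measure (hμs.mono fun θ h => Or.inl h) _,
      Measure.ae_smul_measure (hνs.mono fun θ h => Or.inr h) _⟩
  · have e1 : μ {θ : State | y ≤ (θ : ℝ)} = 0 := by
      refine measure_mono_null (fun θ hθ => ?_) hμs
      exact fun h => absurd (le_trans hθ h.2) (not_le.2 h2)
    have e2 : ν {θ : State | y ≤ (θ : ℝ)} = 1 := by
      rw [← measure_univ (μ := ν)]
      refine measure_congr ?_
      filter_upwards [hνs] with θ hθ
      exact propext ⟨fun _ => trivial, fun _ => hθ.1⟩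
    simp [Measure.real, e1, e2]

theorem principalPayoff_le (G : Game n) [IsProbabilityMeasure G.F] (hu : ∀ θ, G.u θ = θ)
    (hc : 0 < G.c) (ω : Outcome) : principalPayoff G ω ≤ 1 + G.c := by
  refine (le_abs_self _).trans (abs_integral_le fun θ => ?_)
  have h1 := abs_state_le θ
  have h2 : |ω.launch θ| ≤ 1 := abs_le.2 ⟨by linarith [(ω.launch_mem θ).1], (ω.launch_mem θ).2⟩
  rw [abs_mul, hu]
  have h3 : |(θ : ℝ) * ω.launch θ - G.c| ≤ 1 + G.c := by
    refine (abs_sub _ _).trans ?_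
    rw [abs_mul, abs_of_pos hc]
    exact add_le_add_left (mul_le_one₀ h1 (abs_nonneg _) h2) _
  exact (mul_le_of_le_one_right (abs_nonneg _) (abs_propose_le ω θ)).trans h3

/-- A prior and a cost for which two conflicting allies with adjacent thresholds make public
messaging strictly better. -/
theorem exists_publicStrictlyBetter (hk : 1 ≤ k) (hkn : k ≤ n) (hε : 0 < ε) (hε1 : ε < 1)
    (hα : ∀ i, α i = -1 ∨ α i = 1) (hδ : Function.Injective (threshold α β))
    (Msg : (S : Type) → [MeasurableSpace S] → MessageSpace S)
    (h : ∃ i j : Fin n, ConflictingAllies α β i j) :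
    ∃ (F : Measure State) (c : ℝ), IsProbabilityMeasure F ∧ (∀ θ, F {θ} = 0) ∧ 0 < c ∧
      PublicStrictlyBetter (linearGame k ε α β F c) Msg := by
  classical
  obtain ⟨i, j, ⟨hne, hαi, hαj, hδ0, hδij, hδ1⟩, hadj⟩ := exists_adjacent_conflictingAllies hα h
  obtain ⟨η, hη, hlo0, hhi1, hηgap, hiso⟩ := exists_isolating_interval hδ hδ0 hδij hδ1 hadj
  set x := threshold α β i with hx
  set y := threshold α β j with hy
  set lo := x - η with hlo
  set hi := y + η with hhi
  have hvi : ∀ μ, α i * μ + β i = x - μ := fun μ => by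
    rw [hx, threshold, hαi]; ring
  have hvj : ∀ μ, α j * μ + β j = μ - y := fun μ => by
    rw [hy, threshold, hαj]; ring
  have hsign : ∀ l, l ≠ i → l ≠ j → (∀ μ ∈ Set.Icc lo hi, 0 < α l * μ + β l) ∨
      (∀ μ ∈ Set.Icc lo hi, α l * μ + β l < 0) := by
    intro l hli hlj
    rcases hα l with ha | ha <;> rcases hiso l hli hlj with hl | hl <;>
      simp only [threshold, ha, div_neg, div_one, neg_neg] at hl
    · exact Or.inr fun μ hμ => by rw [ha]; linarith [hμ.1]
    · exact Or.inl fun μ hμ => by rw [ha]; linarith [hμ.2]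
    · exact Or.inl fun μ hμ => by rw [ha]; linarith [hμ.1]
    · exact Or.inr fun μ hμ => by rw [ha]; linarith [hμ.2]
  have hxI : x ∈ Set.Icc lo hi := ⟨by linarith, by linarith⟩
  -- The votes at means strictly between `x` and `y`: both allies reject, and the others have the
  -- same sign on all of `Icc lo hi`, so evaluating them at `x` is enough.
  set mid : Fin n → ℝ := fun l => if l ≠ i ∧ l ≠ j ∧ 0 < α l * x + β l then 1 else 0 with hmid
  have hmid1 : ∀ l, mid l ∈ Set.Icc (0 : ℝ) 1 := fun l => by
    simp only [hmid]; split_ifs <;> simp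
  have hmidi : mid i = 0 := by simp [hmid]
  have hmidj : mid j = 0 := by simp [hmid]
  have hmidbest : ∀ l, l ≠ i → l ≠ j → ∀ μ ∈ Set.Icc lo hi, BestVote (α l * μ + β l) (mid l) := by
    intro l hli hlj μ hμ
    rcases hsign l hli hlj with hs | hs
    · have : mid l = 1 := by simp [hmid, hli, hlj, hs x hxI]
      rw [this]
      exact ⟨fun _ => (hs μ hμ).le, fun h => absurd h (lt_irrefl _)⟩
    · have : mid l = 0 := by simp [hmid, not_lt.2 (hs x hxI).le]
      rw [this]
      exact ⟨fun h => absurd h (lt_irrefl _), fun _ => (hs μ hμ).le⟩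
  have hmidle : ∀ l, l ≠ i → l ≠ j → ∀ μ ∈ Set.Icc lo hi, ∀ a ∈ Set.Icc (0 : ℝ) 1,
      (0 < a → 0 ≤ α l * μ + β l) → a ≤ mid l := by
    intro l hli hlj μ hμ a ha hpos
    rcases hsign l hli hlj with hs | hs
    · have : mid l = 1 := by simp [hmid, hli, hlj, hs x hxI]
      rw [this]
      exact ha.2
    · by_contra hlt
      exact absurd (hpos (lt_of_le_of_lt (hmid1 l).1 (not_le.1 hlt))) (not_le.2 (hs μ hμ))
  -- After the high signal `j` joins the supporters in `mid`, after the low signal `i` does.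
  set av : Bool → Fin n → ℝ := fun b => Function.update mid (cond b j i) 1 with hav
  have hav1 : ∀ b l, av b l ∈ Set.Icc (0 : ℝ) 1 := by
    intro b l
    simp only [hav]
    by_cases hl : l = cond b j i
    · rw [hl, Function.update_self]; simp
    · rw [Function.update_of_ne hl]; exact hmid1 l
  set L₀ := rationalLaunch k ε mid with hL₀
  set L₁ := rationalLaunch k ε (av true) with hL₁
  have hLeq : ∀ b, rationalLaunch k ε (av b) = L₁ := by
    intro b
    cases b
    · rw [hL₁, rationalLaunch, rationalLaunch,
        ← launchProb_comp_perm k (fun l => acceptProb ε (av true l)) (Equiv.swap i j)]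
      congr 1
      ext l
      simp only [Function.comp]
      congr 1
      simp only [hav, cond_true, cond_false]
      by_cases hli : l = i
      · subst hli; simp
      · by_cases hlj : l = j
        · subst hlj
          simp [Function.update_of_ne hne, Function.update_of_ne hli, hmidi, hmidj]
        · rw [Equiv.swap_apply_of_ne_of_ne hli hlj, Function.update_of_ne hli,
            Function.update_of_ne hlj]
    · rfl
  have hL01 : L₀ < L₁ := by
    refine rationalLaunch_lt hk hkn hε hε1 hmid1 (i := j) (fun l hl => ?_) ?_
    · simp [hav, Function.update_of_ne hl]
    · simp [hav, hmidj]
  have hL₀0 : 0 ≤ L₀ := (rationalLaunch_mem hε hε1 hmid1).1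
  have hL₁0 : 0 < L₁ := hL₀0.trans_lt hL01
  obtain ⟨F, hF, hF0, hFs, hFhalf⟩ := exists_two_cluster_prior (lo := lo) (x := x) (y := y)
    (hi := hi) (by linarith) (by linarith) hδij (by linarith) hhi1.le
  -- Half of the least possible gain from a proposal launched with probability `L₁`: disclosure
  -- makes proposing profitable after both signals, and forgone mass loses at least `c` per unit.
  set c := lo * L₁ / 2 with hcdef
  have hc : 0 < c := by positivity
  refine ⟨F, c, hF, hF0, hc, ?_⟩
  have : IsProbabilityMeasure (linearGame k ε α β F c).F := hF
  have hHm : MeasurableSet {θ : State | y ≤ (θ : ℝ)} := measurable_subtype_coe measurableSet_Ici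
  set g : State → ℝ := Set.indicator {θ : State | y ≤ (θ : ℝ)} fun _ => 1 with hg
  have hgm : Measurable g := measurable_const.indicator hHm
  have hg1 : ∀ θ, g θ ∈ Set.Icc (0 : ℝ) 1 := fun θ => by
    by_cases hθ : θ ∈ {θ : State | y ≤ (θ : ℝ)} <;> simp [hg, hθ]
  set T := binaryTestOf g hgm hg1 with hT
  have hprob1 : ∫ θ, T.g true θ ∂F = 1 / 2 := by
    change ∫ θ, g θ ∂F = 1 / 2
    rw [← hFhalf]
    exact integral_indicator_one hHm
  have hprob0 : ∫ θ, T.g false θ ∂F = 1 / 2 := by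
    change ∫ θ, (1 - g θ) ∂F = 1 / 2
    refine (integral_sub (integrable_const 1) (T.integrable_g F true)).trans ?_
    rw [hprob1]
    norm_num
  have hTint : ∀ b, Integrable (fun θ : State => θ * T.g b θ) F := fun b => by
    have := T.measurable b
    refine integrable_of_abs_le (by fun_prop) (C := 1) fun θ => ?_
    rw [abs_mul]
    exact mul_le_one₀ (abs_state_le θ) (abs_nonneg _) (T.abs_le_one b θ)
  have hmeanb : ∀ b p q, (∀ᵐ θ ∂F, p * T.g b θ ≤ θ * T.g b θ ∧ θ * T.g b θ ≤ q * T.g b θ) →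
      T.mean F b ∈ Set.Icc p q := by
    intro b p q hpq
    have h1 := T.mean_mul_prob F b
    have h2 : ∫ θ, T.g b θ ∂F = 1 / 2 := by cases b <;> assumption
    have h3 := integral_mono_ae ((T.integrable_g F b).const_mul p) (hTint b)
      (hpq.mono fun θ h => h.1)
    have h4 := integral_mono_ae (hTint b) ((T.integrable_g F b).const_mul q)
      (hpq.mono fun θ h => h.2)
    rw [integral_const_mul, h2] at h3 h4
    rw [h2] at h1
    constructor <;> linarith
  have hmean1 : T.mean F true ∈ Set.Icc y hi := by
    refine hmeanb true y hi ?_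
    filter_upwards [hFs] with θ hθ
    change y * g θ ≤ θ * g θ ∧ θ * g θ ≤ hi * g θ
    by_cases hyθ : y ≤ (θ : ℝ)
    · have : g θ = 1 := by simp [hg, hyθ]
      rw [this]
      rcases hθ with hθ | hθ
      · exact ⟨by linarith, by linarith [hθ.2]⟩
      · exact ⟨by linarith, by linarith [hθ.2]⟩
    · have : g θ = 0 := by simp [hg, hyθ]
      simp [this]
  have hmean0 : T.mean F false ∈ Set.Icc lo x := by
    refine hmeanb false lo x ?_
    filter_upwards [hFs] with θ hθ
    change lo * (1 - g θ) ≤ θ * (1 - g θ) ∧ θ * (1 - g θ) ≤ x * (1 - g θ)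
    by_cases hyθ : y ≤ (θ : ℝ)
    · have : g θ = 1 := by simp [hg, hyθ]
      simp [this]
    · have : g θ = 0 := by simp [hg, hyθ]
      rw [this]
      rcases hθ with hθ | hθ
      · exact ⟨by linarith [hθ.1], by linarith [hθ.2]⟩
      · exact absurd hθ.1 hyθ
  set E := ∫ θ, (θ : ℝ) ∂F with hE
  have hEmean : E = (T.mean F true + T.mean F false) / 2 := by
    have h1 := T.mean_mul_prob F true
    have h0 := T.mean_mul_prob F false
    rw [hprob1] at h1
    rw [hprob0] at h0
    have : E = (∫ θ, θ * T.g true θ ∂F) + ∫ θ, θ * T.g false θ ∂F := by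
      rw [← integral_add (hTint true) (hTint false)]
      simp [← mul_add, T.sum_eq_one, hE]
    rw [this, ← h1, ← h0]
    ring
  have hEx : x < E := by rw [hEmean]; linarith [hmean1.1, hmean0.1]
  have hEy : E < y := by rw [hEmean]; linarith [hmean1.2, hmean0.2]
  have hpub : L₁ * E - c ∈ publicPayoffs (linearGame k ε α β F c) Msg := by
    refine mem_publicPayoffs F T Msg hk hkn hε hε1 hav1 (fun b l => ?_) hLeq fun b => ?_
    · cases b
      · by_cases hli : l = i
        · have h1 : av false l = 1 := by simp [hav, hli]
          rw [h1, hli, hvi]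
          exact ⟨fun _ => by linarith [hmean0.2], fun h => absurd h (lt_irrefl _)⟩
        · have h1 : av false l = mid l := by simp [hav, Function.update_of_ne hli]
          rw [h1]
          by_cases hlj : l = j
          · rw [hlj, hmidj, hvj]
            exact ⟨fun h => absurd h (lt_irrefl _), fun _ => by linarith [hmean0.2]⟩
          · exact hmidbest l hli hlj _ ⟨hmean0.1, by linarith [hmean0.2]⟩
      · by_cases hlj : l = j
        · have h1 : av true l = 1 := by simp [hav, hlj]
          rw [h1, hlj, hvj]
          exact ⟨fun _ => by linarith [hmean1.1], fun h => absurd h (lt_irrefl _)⟩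
        · have h1 : av true l = mid l := by simp [hav, Function.update_of_ne hlj]
          rw [h1]
          by_cases hli : l = i
          · rw [hli, hmidi, hvi]
            exact ⟨fun h => absurd h (lt_irrefl _), fun _ => by linarith [hmean1.1]⟩
          · exact hmidbest l hli hlj _ ⟨by linarith [hmean1.1], hmean1.2⟩
    · have h1 : lo ≤ T.mean F b := by
        cases b
        · exact hmean0.1
        · linarith [hmean1.1]
      have h2 := mul_le_mul_of_nonneg_right h1 hL₁0.le
      have h3 : 0 < lo * L₁ := mul_pos hlo0 hL₁0
      linarith
  have hFlo : ∀ᵐ θ : State ∂F, lo ≤ (θ : ℝ) ∧ (θ : ℝ) ≤ hi := by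
    filter_upwards [hFs] with θ hθ
    rcases hθ with hθ | hθ
    · exact ⟨hθ.1, by linarith [hθ.2]⟩
    · exact ⟨by linarith [hθ.1], hθ.2⟩
  -- The four entries bound the loss in the cases below: the mean lies in the gap (first two), at
  -- most `x` (third), or at least `y` (fourth). The second also covers outcomes without proposals.
  set κ := min (min ((L₁ - L₀) * lo) c) (min (c * (E - x)) (c * (y - E))) with hκ
  have hκpos : 0 < κ := lt_min (lt_min (mul_pos (sub_pos.2 hL01) hlo0) hc)
    (lt_min (mul_pos hc (sub_pos.2 hEx)) (mul_pos hc (sub_pos.2 hEy)))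
  have hκ1 : κ ≤ (L₁ - L₀) * lo := (min_le_left _ _).trans (min_le_left _ _)
  have hκ2 : κ ≤ c := (min_le_left _ _).trans (min_le_right _ _)
  have hκ3 : κ ≤ c * (E - x) := (min_le_right _ _).trans (min_le_left _ _)
  have hκ4 : κ ≤ c * (y - E) := (min_le_right _ _).trans (min_le_right _ _)
  have hlocost : lo * L₁ = 2 * c := by rw [hcdef]; ring
  have hpri : ∀ w ∈ privatePayoffs (linearGame k ε α β F c) Msg, w ≤ L₁ * E - c - κ := by
    rintro w ⟨t, ω, ⟨ρ, hρ, hω⟩, rfl⟩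
    rcases hρ.exists_votes hk hkn hε hε1 hc hω with h0 | ⟨a, ha, hL, hvote⟩
    · have h1 : principalPayoff (linearGame k ε α β F c) ω = 0 := by simp [principalPayoff, h0]
      have h2 := mul_le_mul_of_nonneg_left (by linarith : lo ≤ E) hL₁0.le
      rw [h1]
      linarith
    have hpay := hL.principalPayoff_eq hω fun _ => rfl
    change _ = rationalLaunch k ε a * (∫ θ, θ * ω.propose θ ∂F) - c * ∫ θ, ω.propose θ ∂F at hpay
    rw [hpay]
    have hpm := hω.measurable_propose
    have hp1 := ω.propose_mem
    have hi1 : Integrable ω.propose F := integrable_of_abs_le hpm (abs_propose_le ω)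
    have hi2 : Integrable (fun θ : State => θ * ω.propose θ) F :=
      integrable_of_abs_le (by fun_prop) (C := 1) fun θ => by
        rw [abs_mul]
        exact mul_le_one₀ (abs_state_le θ) (abs_nonneg _) (abs_propose_le ω θ)
    have hi3 : Integrable (fun θ => 1 - ω.propose θ) F := (integrable_const 1).sub hi1
    have hi4 : Integrable (fun θ : State => θ * (1 - ω.propose θ)) F :=
      ((integrable_state F).sub hi2).congr (ae_of_all _ fun θ => by
        simp only [Pi.sub_apply]; ring)
    have hN₀ : ∫ θ, θ * (1 - ω.propose θ) ∂F = E - ∫ θ, θ * ω.propose θ ∂F := by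
      rw [hE, ← integral_sub (integrable_state F) hi2]
      exact integral_congr_ae (ae_of_all _ fun θ => by simp only; ring)
    have hD₀ : ∫ θ, (1 - ω.propose θ) ∂F = 1 - ∫ θ, ω.propose θ ∂F := by
      rw [integral_sub (integrable_const 1) hi1]; simp
    have b1 := integral_mono_ae (hi1.const_mul lo) hi2 (hFlo.mono fun θ h =>
      mul_le_mul_of_nonneg_right h.1 (hp1 θ).1)
    have b2 := integral_mono_ae hi2 (hi1.const_mul hi) (hFlo.mono fun θ h =>
      mul_le_mul_of_nonneg_right h.2 (hp1 θ).1)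
    have b3 := integral_mono_ae (hi3.const_mul lo) hi4 (hFlo.mono fun θ h =>
      mul_le_mul_of_nonneg_right h.1 (sub_nonneg.2 (hp1 θ).2))
    have b4 := integral_mono_ae hi4 (hi3.const_mul hi) (hFlo.mono fun θ h =>
      mul_le_mul_of_nonneg_right h.2 (sub_nonneg.2 (hp1 θ).2))
    rw [integral_const_mul] at b1 b2 b3 b4
    rw [hN₀, hD₀] at b3 b4
    have hD0 : 0 ≤ ∫ θ, ω.propose θ ∂F := integral_nonneg fun θ => (hp1 θ).1
    have hD1 : 0 ≤ 1 - ∫ θ, ω.propose θ ∂F := by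
      rw [← hD₀]; exact integral_nonneg fun θ => sub_nonneg.2 (hp1 θ).2
    set N := ∫ θ, θ * ω.propose θ ∂F with hN
    set D := ∫ θ, ω.propose θ ∂F with hD
    set L := rationalLaunch k ε a with hLdef
    -- The shortfall from `L₁ * E - c` is `(L₁ - L) * N + L₁ * (E - N) - c * (1 - D)`, and `L₁ * (E
    -- - N)` is at least `2 * c * (1 - D)`.
    suffices hgain : κ ≤ (L₁ - L) * N + c * (1 - D) by
      have h1 := mul_le_mul_of_nonneg_left b3 hL₁0.le
      have h2 : L₁ * (lo * (1 - D)) = 2 * c * (1 - D) := by rw [← hlocost]; ring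
      linarith
    rcases hD0.eq_or_lt with hDz | hDpos
    · have : N = 0 := by
        rw [← hDz] at b1 b2
        linarith
      rw [this, ← hDz]
      linarith
    have hNlo : 0 < N := (mul_pos hlo0 hDpos).trans_le b1
    set μ := N / D with hμ
    have hμI : μ ∈ Set.Icc lo hi := ⟨(le_div_iff₀ hDpos).2 b1, (div_le_iff₀ hDpos).2 b2⟩
    have hμD : μ * D = N := div_mul_cancel₀ _ hDpos.ne'
    have hvoteμ : ∀ l, 0 < a l → 0 ≤ α l * μ + β l := fun l hl => by
      have h1 := hvote l hl
      refine nonneg_of_mul_nonneg_left (b := D) ?_ hDpos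
      rw [add_mul, mul_assoc, hμD]
      exact h1
    have hai : x < μ → a i ≤ 0 := fun h => by
      by_contra hlt
      have := hvoteμ i (not_le.1 hlt)
      rw [hvi] at this
      linarith
    have haj : μ < y → a j ≤ 0 := fun h => by
      by_contra hlt
      have := hvoteμ j (not_le.1 hlt)
      rw [hvj] at this
      linarith
    have hother : ∀ l, l ≠ i → l ≠ j → a l ≤ mid l := fun l hli hlj =>
      hmidle l hli hlj μ hμI (a l) (ha l) (hvoteμ l)
    -- With a mean at most `x` or at least `y`, one ally can still be won, but this takes a proposal
    -- probability bounded away from one, as the prior mean `E` lies in the gap. In between neither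
    -- ally accepts and the launch probability is at most `L₀ < L₁`.
    rcases le_or_gt μ x with hμx | hμx
    · have hle : L ≤ L₁ := by
        rw [← hLeq false]
        refine rationalLaunch_mono hε hε1 ha (hav1 false) fun l => ?_
        by_cases hli : l = i
        · rw [hli]; simpa [hav] using (ha i).2
        · have h1 : av false l = mid l := by simp [hav, Function.update_of_ne hli]
          rw [h1]
          by_cases hlj : l = j
          · rw [hlj, hmidj]; exact haj (by linarith)
          · exact hother l hli hlj
      have h1 : N ≤ x * D := by rw [← hμD]; exact mul_le_mul_of_nonneg_right hμx hDpos.le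
      -- The prior mean is at most `x * D + hi * (1 - D)`, so `E - x ≤ (hi - x) * (1 - D)`.
      have h2 : E - x ≤ 1 - D := by
        have := mul_le_of_le_one_left hD1 (by linarith : hi - x ≤ 1)
        linarith
      have h3 := mul_le_mul_of_nonneg_left h2 hc.le
      have h4 := mul_nonneg (sub_nonneg.2 hle) hNlo.le
      linarith
    rcases lt_or_ge μ y with hμy | hμy
    · have hle : L ≤ L₀ := by
        refine rationalLaunch_mono hε hε1 ha hmid1 fun l => ?_
        by_cases hli : l = i
        · rw [hli, hmidi]; exact hai hμx
        · by_cases hlj : l = j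
          · rw [hlj, hmidj]; exact haj hμy
          · exact hother l hli hlj
      -- The bound on the loss is split as `κ * D + κ * (1 - D)`, the first part from fewer launches
      -- and the second from forgone proposals.
      have h1 : (L₁ - L₀) * (lo * D) ≤ (L₁ - L) * N :=
        mul_le_mul (by linarith) b1 (mul_nonneg hlo0.le hDpos.le) (by linarith)
      have h2 := mul_le_mul_of_nonneg_right hκ1 hDpos.le
      have h3 := mul_le_mul_of_nonneg_right hκ2 hD1
      linarith
    · have hle : L ≤ L₁ := by
        rw [← hLeq true]
        refine rationalLaunch_mono hε hε1 ha (hav1 true) fun l => ?_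
        by_cases hlj : l = j
        · rw [hlj]; simpa [hav] using (ha j).2
        · have h1 : av true l = mid l := by simp [hav, Function.update_of_ne hlj]
          rw [h1]
          by_cases hli : l = i
          · rw [hli, hmidi]; exact hai hμx
          · exact hother l hli hlj
      have h1 : y * D ≤ N := by rw [← hμD]; exact mul_le_mul_of_nonneg_right hμy hDpos.le
      have h2 : y - E ≤ 1 - D := by
        have := mul_le_of_le_one_left hD1 (by linarith : y - lo ≤ 1)
        linarith
      have h3 := mul_le_mul_of_nonneg_left h2 hc.le
      have h4 := mul_nonneg (sub_nonneg.2 hle) hNlo.le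
      linarith
  have hbdd : BddAbove (publicPayoffs (linearGame k ε α β F c) Msg) := by
    refine ⟨1 + c, ?_⟩
    rintro w ⟨t, ω, -, rfl⟩
    exact principalPayoff_le (linearGame k ε α β F c) (fun _ => rfl) hc ω
  obtain ⟨v₀, hv₀, -⟩ :=
    exists_nonneg_mem_privatePayoffs (α := α) (β := β) F Msg hk hkn hε hε1 hc
  refine ⟨_, _, isLUB_csSup ⟨_, hpub⟩ hbdd, isLUB_csSup ⟨v₀, hv₀⟩ ⟨_, hpri⟩, ?_⟩
  have h1 := csSup_le ⟨v₀, hv₀⟩ hpri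
  have h2 := le_csSup hbdd hpub
  linarith

end Conflict

end Messaging

theorem mainTheorem5 (n : ℕ) (hn : 2 ≤ n) (k : ℕ) (hk : 1 ≤ k) (hkn : k ≤ n)
    (ε : ℝ) (hε : 0 < ε) (hε1 : ε < 1) (α β : Fin n → ℝ)
    (hα : ∀ i, α i = -1 ∨ α i = 1) (hβ : ∀ i, β i ∈ Set.Ioo (-1 : ℝ) 1)
    (hδ : Function.Injective (Messaging.threshold α β))
    (Msg : (S : Type) → [MeasurableSpace S] → Messaging.MessageSpace S) :
    (∃ (F : Measure Messaging.State) (c : ℝ), IsProbabilityMeasure F ∧ (∀ θ, F {θ} = 0) ∧ 0 < c ∧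
        Messaging.PublicStrictlyBetter (Messaging.linearGame k ε α β F c) Msg) ↔
      ∃ i j : Fin n, Messaging.ConflictingAllies α β i j := by
  refine ⟨?_, Messaging.exists_publicStrictlyBetter hk hkn hε hε1 hα hδ Msg⟩
  rintro ⟨F, c, hF, -, hc, Vpub, Vpri, hpub, hpri, hlt⟩
  by_contra hno
  -- Each public payoff is at most some private payoff, so the private supremum bounds the public
  -- one.
  refine absurd hlt (not_lt.2 (hpub.2 fun w hw => ?_))
  obtain ⟨v, hv, hwv⟩ := Messaging.exists_privatePayoff_ge F Msg (by omega) hk hkn hε hε1 hc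
    hα hβ hno hw
  exact hwv.trans (hpri.1 hv)
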